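/- Let $k\ge 2$ be an integer and let $\alpha\in\mathbb C$ with $0<|\alpha|<2$. Write $\Omega(n)$ for the number of prime factors of $n$ counted with multiplicity, and for $f:\mathbb R\to\mathbb C$ and real $N\ge 2$ put $$S_{f}(k,\alpha;N)=\sum_{\substack{n\ \ k\text{-free}\\ p\mid n\Rightarrow p\le N}} f\!\left(\frac{\log n}{\log N}\right)\frac{\alpha^{\Omega(n)}}{n},\qquad \varphi^{(\alpha)}(\lambda)=\exp\left\{\alpha\int_0^1\frac{e^{i\lambda v}-1}{v}\,dv\right\}.$$ Then there is a constant $C=C(k,\alpha)\neq 0$ with the following property. Let $\eta>|\alpha|-\Re\alpha+1$ and let $f:\mathbb R\to\mathbb C$ be a bounded continuous function whose Fourier transform $\hat f$ (normalized as $\hat f(\lambda)=\frac1{2\pi}\int_{\mathbb R} f(x)e^{-i\lambda x}\,dx$, and understood in the sense of tempered distributions if $f$ is not integrable) is a function satisfying $|\hat f(\lambda)|\le A/(1+|\lambda|^\eta)$ for all $\lambda\in\mathbb R$ and some $A>0$. For $\tau\in\mathbb R$ put $R(N)=(\log N)^{1-\tau}$ and define $\varepsilon_N$ by $$S_{f}(k,\alpha;N)=C\,(\log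 N)^{\alpha}\left(\int_{|\lambda|\le R(N)}\varphi^{(\alpha)}(\lambda)\hat f(\lambda)\,d\lambda+\varepsilon_N\right)\qquad(N\ge2).$$ Then, as $N\to\infty$, (a) if $0<\tau\le\frac{\eta-(|\alpha|-\Re\alpha+2)}{\eta-1}$, then $\varepsilon_N=O\!\left(\frac{\log\log N}{\log N}\right)$; (b) if $\max\left(0,\frac{\eta-(|\alpha|-\Re\alpha+2)}{\eta-1}\right)<\tau<\frac{\eta-(|\alpha|-\Re\alpha+1)}{\eta-1}$, then $\varepsilon_N=O\!\left((\log N)^{-\eta(1-\tau)-\tau+|\alpha|-\Re\alpha+1}\right)$. The implied constants may depend on $k,\alpha,\eta,f,\tau$. -/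

import Mathlib

namespace SmoothSums

/-- The `k`-free positive integers all of whose prime factors are at most `N`
(`0` is excluded, as it is divisible by every prime power). -/
def smoothKFree (k : ℕ) (N : ℝ) : Set ℕ :=
  {n : ℕ | (∀ p : ℕ, p.Prime → ¬ p ^ k ∣ n) ∧ ∀ p : ℕ, p.Prime → p ∣ n → (p : ℝ) ≤ N}

theorem smoothKFree_finite (k : ℕ) (N : ℝ) : (smoothKFree k N).Finite := by
  have hQ : (∏ p ∈ (Finset.range (⌊N⌋₊ + 1)).filter Nat.Prime, p ^ k) ≠ 0 :=
    Finset.prod_ne_zero_iff.mpr fun p hp =>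
      pow_ne_zero _ (Finset.mem_filter.mp hp).2.ne_zero
  refine (Nat.divisors
    (∏ p ∈ (Finset.range (⌊N⌋₊ + 1)).filter Nat.Prime, p ^ k)).finite_toSet.subset ?_
  rintro n ⟨hn, hN⟩
  simp only [Finset.mem_coe, Nat.mem_divisors]
  refine ⟨(Nat.dvd_iff_prime_pow_dvd_dvd _ _).mpr fun p j hp hj => ?_, hQ⟩
  rcases Nat.eq_zero_or_pos j with rfl | hj0
  · simp
  have hpn : p ∣ n := (dvd_pow_self p hj0.ne').trans hj
  have hjk : j ≤ k := by
    by_contra! h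
    exact hn p hp ((pow_dvd_pow p h.le).trans hj)
  refine (pow_dvd_pow p hjk).trans (Finset.dvd_prod_of_mem (fun p => p ^ k) ?_)
  simp only [Finset.mem_filter, Finset.mem_range]
  exact ⟨Nat.lt_succ_of_le (Nat.le_floor (hN p hp hpn)), hp⟩

/-- The sum of `f (log n / log N) * α ^ Ω(n) / n` over the `k`-free `N`-smooth integers `n`,
where `Ω(n)` counts the prime divisors of `n` with multiplicity. -/
noncomputable def smoothSum (f : ℝ → ℂ) (k : ℕ) (α : ℂ) (N : ℝ) : ℂ :=
  ∑ n ∈ (smoothKFree_finite k N).toFinset,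
    f (Real.log n / Real.log N) * (α ^ ArithmeticFunction.cardFactors n / (n : ℂ))

/-- The Fourier transform in the normalization
`(1 / 2π) ∫ f(x) exp(-iλx) dx`, inverse to `g ↦ ∫ g(λ) exp(iλx) dλ`. -/
noncomputable def fourierTransform (f : ℝ → ℂ) (lam : ℝ) : ℂ :=
  (1 / (2 * (Real.pi : ℂ))) * ∫ x : ℝ, Complex.exp (-(Complex.I * lam * x)) * f x

/-- `g` is the Fourier transform of `f` in the sense of tempered distributions (for integrable
`f` this holds with `g = fourierTransform f`). -/
def IsFourierTransform (f g : ℝ → ℂ) : Prop :=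
  ∀ ψ : SchwartzMap ℝ ℂ,
    MeasureTheory.Integrable (fun lam : ℝ => g lam * ψ lam) ∧
      ∫ lam : ℝ, g lam * ψ lam = ∫ x : ℝ, f x * fourierTransform ψ x

/-- `f` belongs to the space `S_η`, with Fourier transform `fhat`. -/
def MemS (η : ℝ) (f fhat : ℝ → ℂ) : Prop :=
  IsFourierTransform f fhat ∧ ∃ A : ℝ, 0 < A ∧ ∀ lam : ℝ, ‖fhat lam‖ ≤ A / (1 + |lam| ^ η)

/-- The characteristic function of the `α`-convolution of the Dickman-de Bruijn distribution. -/
noncomputable def dickmanChar (α : ℂ) (lam : ℝ) : ℂ :=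
  Complex.exp (α * ∫ v in (0 : ℝ)..1, (Complex.exp (Complex.I * lam * v) - 1) / (v : ℂ))

/-- The integral over `|λ| ≤ R` of `dickmanChar α λ * fhat λ`. -/
noncomputable def mainIntegral (α : ℂ) (fhat : ℝ → ℂ) (R : ℝ) : ℂ :=
  ∫ lam in {lam : ℝ | |lam| ≤ R}, dickmanChar α lam * fhat lam

end SmoothSums

namespace SmoothSums

open Finset Real MeasureTheory
open scoped FourierTransform

/-! By Fourier inversion `f(x) = ∫ f̂(λ) e^{iλx} dλ`, so the sum equals `∫ f̂(λ) P(λ / log N) dλ`,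
where `P(t) = ∏_{p ≤ N} ∑_{j<k} (α p^{-1+it})^j` is a finite Euler product. The integral is cut at
`|λ| = R`.

For `|λ| ≤ R` the product is replaced by its asymptotic form. As `|α| < 2`, each local factor is
`exp(w + O(|w|²))` with `w = α p^{-1+it}`. The linear terms are `α ∑ 1/p`, which Mertens' second
theorem evaluates, plus `α ∑ (p^{it} - 1)/p`, which partial summation from Mertens' first theorem
turns into `α ∫_0^1 (e^{iλv} - 1)/v dv`. The quadratic remainders converge to a constant. Hence `P =
C (log N)^α φ(λ) e^E` with `E = O((1 + |λ|)(1 + |log log N|) / log N)` (`exists_eulerProd_eq`).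
Since `|φ(λ)| ≪ (1 + |λ|)^{-Re α}` (`norm_dickmanChar_le`), the error there is an integral of `(1 +
|λ|)^{1 - Re α - η}` times `(1 + |log log N|) / log N`.

For `|λ| > R` only `|P| ≪ (log N)^{|α|}` is used (`exists_norm_eulerProd_le`). Relative to the main
term this loses `(log N)^{|α| - Re α}`, against the tail `R^{1-η}` of `f̂`. With `R = (log N)^{1-τ}`
the tail error is `(log N)^{|α| - Re α + (1-τ)(1-η)}`: at most `1 / log N` in range (a), and
dominant in range (b). -/

/-! ### Mertens' first theorem -/

theorem summable_log_div_sq : Summable fun n : ℕ => Real.log n / (n : ℝ) ^ 2 := by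
  have h : Summable fun n : ℕ => 2 * (1 / (n : ℝ) ^ (3 / 2 : ℝ)) :=
    (Real.summable_one_div_nat_rpow.mpr (by norm_num)).mul_left 2
  refine Summable.of_nonneg_of_le (fun n => by positivity) (fun n => ?_) h
  rcases Nat.eq_zero_or_pos n with rfl | hn
  · simp
  have hn' : (0 : ℝ) < n := by exact_mod_cast hn
  have h1 : Real.log n ≤ (n : ℝ) ^ (1 / 2 : ℝ) / (1 / 2) :=
    Real.log_le_rpow_div hn'.le (by norm_num)
  have h2 : (n : ℝ) ^ 2 = (n : ℝ) ^ (1 / 2 : ℝ) * (n : ℝ) ^ (3 / 2 : ℝ) := by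
    rw [← Real.rpow_add hn', ← Real.rpow_natCast]; norm_num
  have h3 : 0 < (n : ℝ) ^ (1 / 2 : ℝ) := by positivity
  have h4 : 0 < (n : ℝ) ^ (3 / 2 : ℝ) := by positivity
  rw [h2, div_le_iff₀ (by positivity)]
  calc Real.log n ≤ (n : ℝ) ^ (1 / 2 : ℝ) / (1 / 2) := h1
    _ = _ := by field_simp

/-- The sum of `log p / p` over the primes `p ≤ x`. -/
noncomputable def primeLogSum (x : ℝ) : ℝ := ∑ p ∈ Nat.primesLE ⌊x⌋₊, Real.log p / p

theorem log_factorial_eq_sum (n : ℕ) :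
    Real.log n.factorial = ∑ p ∈ Nat.primesLE n, n.factorial.factorization p * Real.log p := by
  conv_lhs => rw [← Nat.prod_factorization_pow_eq_self n.factorial_ne_zero]
  rw [Finsupp.prod, Nat.cast_prod, Real.log_prod]
  · have hs : n.factorial.factorization.support ⊆ Nat.primesLE n := by
      intro p hp
      rw [Nat.support_factorization, Nat.mem_primeFactors] at hp
      exact Nat.mem_primesLE.mpr ⟨(hp.1.dvd_factorial).mp hp.2.1, hp.1⟩
    rw [← Finset.sum_subset hs]
    · refine Finset.sum_congr rfl fun p _ => ?_
      push_cast
      rw [Real.log_pow]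
    · intro p _ hp
      simp [Finsupp.notMem_support_iff.mp hp]
  · intro p hp
    rw [Nat.support_factorization, Nat.mem_primeFactors] at hp
    exact_mod_cast pow_ne_zero _ hp.1.ne_zero

/-- The exponent of `p` in `n!` is at least `⌊n/p⌋ > n/p - 1`. Replacing `⌊n/p⌋` by `n/p` costs
`θ(n) ≤ n log 4` in total, while `log n! ≤ n log n`. -/
theorem primeLogSum_natCast_le {n : ℕ} (hn : n ≠ 0) :
    primeLogSum n ≤ Real.log n + Real.log 4 := by
  have hn' : (0 : ℝ) < n := by exact_mod_cast Nat.pos_of_ne_zero hn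
  have h1 : n * primeLogSum n - Chebyshev.theta n ≤ Real.log n.factorial := by
    rw [log_factorial_eq_sum, Chebyshev.theta_eq_sum_primesLE_log, primeLogSum, Nat.floor_natCast,
      Finset.mul_sum, ← Finset.sum_sub_distrib]
    refine Finset.sum_le_sum fun p hp => ?_
    have hpp := Nat.prime_of_mem_primesLE hp
    have hple := Nat.le_of_mem_primesLE hp
    have hlog : 0 ≤ Real.log p := Real.log_natCast_nonneg p
    have h2 : n / p ≤ n.factorial.factorization p := by
      rw [Nat.factorization_factorial hpp (b := Nat.log p n + 1) (Nat.lt_succ_self _)]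
      have : 1 ∈ Finset.Ico 1 (Nat.log p n + 1) := by
        simp only [Finset.mem_Ico, le_refl, true_and]
        have := Nat.log_pos hpp.one_lt hple
        omega
      simpa using Finset.single_le_sum (f := fun i => n / p ^ i) (fun _ _ => Nat.zero_le _) this
    have h3 : (n : ℝ) / p - 1 ≤ (n / p : ℕ) := by
      rw [← Nat.floor_div_eq_div (K := ℝ)]
      exact (Nat.sub_one_lt_floor _).le
    have h4 : (n : ℝ) / p - 1 ≤ n.factorial.factorization p := h3.trans (by exact_mod_cast h2)
    calc (n : ℝ) * (Real.log p / p) - Real.log p = (n / p - 1) * Real.log p := by ring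
      _ ≤ _ := mul_le_mul_of_nonneg_right h4 hlog
  have h5 : Real.log n.factorial ≤ n * Real.log n := by
    rw [← Real.log_pow]
    exact Real.log_le_log (by exact_mod_cast n.factorial_pos) (by exact_mod_cast n.factorial_le_pow)
  have h6 := Chebyshev.theta_le_log4_mul_x hn'.le
  have h7 : n * primeLogSum n ≤ n * (Real.log n + Real.log 4) := by linarith
  exact le_of_mul_le_mul_left h7 hn'

/-- The exponent of `p` in `n!` is at most `n/(p-1)`, which exceeds `n/p` by `O(n/p²)`; the excess
sums to a convergent series. Stirling bounds `log n!` from below. -/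
theorem le_primeLogSum_natCast {n : ℕ} (hn : n ≠ 0) :
    Real.log n - 1 - 2 * ∑' m : ℕ, Real.log m / (m : ℝ) ^ 2 ≤ primeLogSum n := by
  have hn' : (0 : ℝ) < n := by exact_mod_cast Nat.pos_of_ne_zero hn
  have hn1 : (1 : ℝ) ≤ n := by exact_mod_cast Nat.one_le_iff_ne_zero.mpr hn
  have h1 : Real.log n.factorial ≤
      n * (primeLogSum n + 2 * ∑' m : ℕ, Real.log m / (m : ℝ) ^ 2) := by
    have hs : ∑ p ∈ Nat.primesLE n, Real.log p / (p : ℝ) ^ 2 ≤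
        ∑' m : ℕ, Real.log m / (m : ℝ) ^ 2 :=
      summable_log_div_sq.sum_le_tsum _ fun m _ => by positivity
    have h2 : Real.log n.factorial ≤
        n * (primeLogSum n + 2 * ∑ p ∈ Nat.primesLE n, Real.log p / (p : ℝ) ^ 2) := by
      rw [log_factorial_eq_sum, primeLogSum, Nat.floor_natCast, Finset.mul_sum,
        ← Finset.sum_add_distrib, Finset.mul_sum]
      refine Finset.sum_le_sum fun p hp => ?_
      have hpp := Nat.prime_of_mem_primesLE hp
      have hlog : 0 ≤ Real.log p := Real.log_natCast_nonneg p
      have hp2 : (2 : ℝ) ≤ p := by exact_mod_cast hpp.two_le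
      have h3 : (n.factorial.factorization p : ℝ) ≤ n / (p - 1) := by
        have := Nat.factorization_factorial_le_div_pred hpp n
        have h4 : ((n / (p - 1) : ℕ) : ℝ) ≤ (n : ℝ) / ((p - 1 : ℕ) : ℝ) := Nat.cast_div_le
        rw [Nat.cast_sub hpp.one_le, Nat.cast_one] at h4
        exact le_trans (by exact_mod_cast this) h4
      -- After clearing denominators this is `p ≥ 2`.
      have h5 : (n : ℝ) / (p - 1) ≤ n * (1 / p + 2 / p ^ 2) := by
        rw [div_eq_mul_inv]
        refine mul_le_mul_of_nonneg_left ?_ hn'.le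
        rw [inv_le_iff_one_le_mul₀ (by linarith)]
        have : (1 / (p : ℝ) + 2 / p ^ 2) * (p - 1) = 1 + (p - 2) / p ^ 2 := by
          field_simp; ring
        rw [this]
        have : 0 ≤ ((p : ℝ) - 2) / p ^ 2 := div_nonneg (by linarith) (by positivity)
        linarith
      calc _ ≤ (n * (1 / p + 2 / p ^ 2)) * Real.log p :=
            mul_le_mul_of_nonneg_right (h3.trans h5) hlog
        _ = _ := by ring
    refine h2.trans (mul_le_mul_of_nonneg_left ?_ hn'.le)
    linarith
  have h2 := Stirling.le_log_factorial_stirling hn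
  have h3 : 0 ≤ Real.log (2 * Real.pi) := Real.log_nonneg (by nlinarith [Real.pi_gt_three])
  have h4 : 0 ≤ Real.log n := Real.log_natCast_nonneg n
  have h5 : n * (Real.log n - 1) ≤ n * (primeLogSum n + 2 * ∑' m : ℕ, Real.log m / (m : ℝ) ^ 2) := by
    linarith
  have := le_of_mul_le_mul_left h5 hn'
  linarith

/-- Mertens' first theorem. -/
theorem exists_abs_primeLogSum_sub_log_le :
    ∃ K : ℝ, 0 < K ∧ ∀ x : ℝ, 1 ≤ x → |primeLogSum x - Real.log x| ≤ K := by
  set T := ∑' m : ℕ, Real.log m / (m : ℝ) ^ 2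
  have hT : 0 ≤ T := tsum_nonneg fun m => by positivity
  refine ⟨3 + Real.log 4 + 2 * T, by positivity, fun x hx => ?_⟩
  have hn : ⌊x⌋₊ ≠ 0 := (Nat.floor_pos.mpr hx).ne'
  have hn1 : (1 : ℝ) ≤ ⌊x⌋₊ := by exact_mod_cast Nat.one_le_iff_ne_zero.mpr hn
  have hA : primeLogSum x = primeLogSum ⌊x⌋₊ := by simp [primeLogSum]
  have h1 := primeLogSum_natCast_le hn
  have h2 := le_primeLogSum_natCast hn
  have h3 : Real.log ⌊x⌋₊ ≤ Real.log x :=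
    Real.log_le_log (by linarith) (Nat.floor_le (by linarith))
  have h4 : Real.log x ≤ Real.log ⌊x⌋₊ + 1 := by
    have : x ≤ ⌊x⌋₊ * 2 := by have := Nat.lt_floor_add_one x; linarith
    have h5 := Real.log_le_log (by linarith) this
    rw [Real.log_mul (by positivity) (by norm_num)] at h5
    linarith [Real.log_two_lt_d9]
  have h5 : 0 ≤ Real.log 4 := Real.log_nonneg (by norm_num)
  rw [hA, abs_le]
  constructor <;> linarith


/-! ### Partial summation over primes and Mertens' second theorem -/

theorem primeLogSum_mono : Monotone primeLogSum := fun x y hxy => by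
  refine Finset.sum_le_sum_of_subset_of_nonneg (Nat.primesLE_mono (Nat.floor_mono hxy)) ?_
  intro p _ _
  positivity

/-- The error term in Mertens' first theorem. -/
noncomputable def primeLogError (x : ℝ) : ℝ := primeLogSum x - Real.log x

theorem measurable_primeLogError : Measurable primeLogError :=
  primeLogSum_mono.measurable.sub Real.measurable_log

/-- Abel summation against `primeLogSum = log + primeLogError`. The `log` part is integrated by
parts back into `∫ f(x)/x`, which leaves the boundary term at 2, so only the bounded error meets
`f'`. -/
theorem sum_mul_log_div_eq {f f' : ℝ → ℂ} {b : ℝ} (hb : 2 ≤ b)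
    (hf : ∀ x ∈ Set.Icc 2 b, HasDerivAt f (f' x) x) (hf' : ContinuousOn f' (Set.Icc 2 b)) :
    ∑ p ∈ Nat.primesLE ⌊b⌋₊, f p * ((Real.log p / p : ℝ) : ℂ) =
      (∫ x in (2 : ℝ)..b, f x / x) + f 2 * Real.log 2 + f b * primeLogError b -
        ∫ x in (2 : ℝ)..b, f' x * primeLogError x := by
  set c : ℕ → ℂ := fun n => if n.Prime then ((Real.log n / n : ℝ) : ℂ) else 0 with hc
  have hsum : ∀ x : ℝ, ∑ k ∈ Finset.Icc 0 ⌊x⌋₊, c k = (primeLogSum x : ℂ) := fun x => by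
    rw [primeLogSum, Nat.primesLE_eq_filter_Icc_zero, Finset.sum_filter, Complex.ofReal_sum]
    refine Finset.sum_congr rfl fun p _ => ?_
    simp only [hc]
    split_ifs <;> simp
  have hsum' : ∑ k ∈ Finset.Icc 0 ⌊b⌋₊, f k * c k =
      ∑ p ∈ Nat.primesLE ⌊b⌋₊, f p * ((Real.log p / p : ℝ) : ℂ) := by
    rw [Nat.primesLE_eq_filter_Icc_zero, Finset.sum_filter]
    refine Finset.sum_congr rfl fun p _ => ?_
    simp only [hc]
    split_ifs <;> simp
  have hderiv : Set.EqOn (deriv f) f' (Set.Icc 2 b) := fun x hx => (hf x hx).deriv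
  have hint' : IntegrableOn f' (Set.Icc 2 b) := hf'.integrableOn_Icc
  have hint : IntegrableOn (deriv f) (Set.Icc 2 b) :=
    hint'.congr_fun hderiv.symm measurableSet_Icc
  have habel := sum_mul_eq_sub_integral_mul₁ c (f := f) (by simp [hc]) (by simp [hc, Nat.not_prime_one])
    b (fun t ht => (hf t ht).differentiableAt) hint
  rw [← hsum', habel, hsum]
  have e1 : ∫ t in Set.Ioc 2 b, deriv f t * ∑ k ∈ Finset.Icc 0 ⌊t⌋₊, c k =
      ∫ t in (2 : ℝ)..b, f' t * primeLogSum t := by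
    rw [intervalIntegral.integral_of_le hb]
    refine setIntegral_congr_fun measurableSet_Ioc fun t ht => ?_
    rw [hsum, hderiv (Set.Ioc_subset_Icc_self ht)]
  have i1 : IntervalIntegrable (fun t => f' t * (primeLogSum t : ℂ)) volume 2 b := by
    rw [intervalIntegrable_iff_integrableOn_Icc_of_le hb]
    refine (integrableOn_mul_sum_Icc c (m := 0) (by norm_num) hint').congr_fun (fun t _ => ?_)
      measurableSet_Icc
    simp only [hsum]
  have hlogc : ContinuousOn (fun x : ℝ => (Real.log x : ℂ)) (Set.Icc 2 b) :=
    Complex.continuous_ofReal.comp_continuousOn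
      (Real.continuousOn_log.mono fun x hx => (show x ≠ 0 by have := hx.1; linarith))
  have i2 : IntervalIntegrable (fun t => f' t * (Real.log t : ℂ)) volume 2 b := by
    rw [intervalIntegrable_iff_integrableOn_Icc_of_le hb]
    exact (hf'.mul hlogc).integrableOn_Icc
  have e2 : ∫ t in (2 : ℝ)..b, f' t * primeLogError t =
      (∫ t in (2 : ℝ)..b, f' t * primeLogSum t) - ∫ t in (2 : ℝ)..b, f' t * Real.log t := by
    rw [← intervalIntegral.integral_sub i1 i2]
    refine intervalIntegral.integral_congr fun t _ => ?_
    simp only [primeLogError]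
    push_cast
    ring
  have e3 : ∫ t in (2 : ℝ)..b, f t * ((t⁻¹ : ℝ) : ℂ) =
      f b * Real.log b - f 2 * Real.log 2 - ∫ t in (2 : ℝ)..b, f' t * Real.log t := by
    refine intervalIntegral.integral_mul_deriv_eq_deriv_mul (u := f) (u' := f')
      (v := fun x => (Real.log x : ℂ)) ?_ ?_ ?_ ?_
    · intro x hx
      rw [Set.uIcc_of_le hb] at hx
      exact hf x hx
    · intro x hx
      rw [Set.uIcc_of_le hb] at hx
      exact (Real.hasDerivAt_log (by linarith [hx.1])).ofReal_comp
    · rw [intervalIntegrable_iff_integrableOn_Icc_of_le hb]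
      exact hint'
    · rw [intervalIntegrable_iff_integrableOn_Icc_of_le hb]
      refine ContinuousOn.integrableOn_Icc ?_
      refine Complex.continuous_ofReal.comp_continuousOn (continuousOn_inv₀.mono fun x hx => ?_)
      have := hx.1
      simp only [Set.mem_compl_iff, Set.mem_singleton_iff]
      linarith
  have e4 : ∫ x in (2 : ℝ)..b, f x / x = ∫ t in (2 : ℝ)..b, f t * ((t⁻¹ : ℝ) : ℂ) := by
    refine intervalIntegral.integral_congr fun t _ => ?_
    simp [div_eq_mul_inv]
  rw [e1, e2, e4, e3, primeLogError]
  push_cast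
  ring

theorem hasDerivAt_neg_inv_log {x : ℝ} (hx : 2 ≤ x) :
    HasDerivAt (fun y => -(Real.log y)⁻¹) (1 / (x * Real.log x ^ 2)) x := by
  have hl : 0 < Real.log x := Real.log_pos (by linarith)
  have h := ((Real.hasDerivAt_log (by linarith : x ≠ 0)).fun_inv hl.ne').fun_neg
  have e : -(-x⁻¹ / Real.log x ^ 2) = 1 / (x * Real.log x ^ 2) := by
    rw [neg_div, neg_neg, one_div, mul_inv, div_eq_mul_inv]
  rwa [e] at h

theorem hasDerivAt_log_log {x : ℝ} (hx : 2 ≤ x) :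
    HasDerivAt (fun y => Real.log (Real.log y)) (1 / (x * Real.log x)) x := by
  have hl : 0 < Real.log x := Real.log_pos (by linarith)
  convert (Real.hasDerivAt_log (by linarith : x ≠ 0)).log hl.ne' using 1
  rw [one_div, mul_inv, div_eq_mul_inv]

theorem tendsto_neg_inv_log : Filter.Tendsto (fun y => -(Real.log y)⁻¹) Filter.atTop (nhds 0) := by
  simpa using (tendsto_inv_atTop_zero.comp Real.tendsto_log_atTop).neg

theorem integrableOn_inv_mul_log_sq {a : ℝ} (ha : 2 ≤ a) :
    IntegrableOn (fun x => 1 / (x * Real.log x ^ 2)) (Set.Ioi a) := by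
  refine integrableOn_Ioi_deriv_of_nonneg' (fun x hx => hasDerivAt_neg_inv_log (ha.trans hx))
    (fun x hx => ?_) tendsto_neg_inv_log
  have : (0 : ℝ) < x := by linarith [Set.mem_Ioi.mp hx]
  positivity

theorem integral_inv_mul_log_sq {a : ℝ} (ha : 2 ≤ a) :
    ∫ x in Set.Ioi a, 1 / (x * Real.log x ^ 2) = 1 / Real.log a := by
  rw [integral_Ioi_of_hasDerivAt_of_tendsto' (fun x hx => hasDerivAt_neg_inv_log (ha.trans hx))
    (integrableOn_inv_mul_log_sq ha) tendsto_neg_inv_log]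
  simp

theorem integral_inv_mul_log {b : ℝ} (hb : 2 ≤ b) :
    ∫ x in (2 : ℝ)..b, 1 / (x * Real.log x) =
      Real.log (Real.log b) - Real.log (Real.log 2) := by
  refine intervalIntegral.integral_eq_sub_of_hasDerivAt
    (f := fun y => Real.log (Real.log y)) (fun x hx => ?_) ?_
  · rw [Set.uIcc_of_le hb] at hx
    exact hasDerivAt_log_log hx.1
  · rw [intervalIntegrable_iff_integrableOn_Icc_of_le hb]
    refine ContinuousOn.integrableOn_Icc fun x hx => ContinuousAt.continuousWithinAt ?_
    have h0 : x ≠ 0 := by linarith [hx.1]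
    have hl : Real.log x ≠ 0 := (Real.log_pos (by linarith [hx.1])).ne'
    fun_prop (disch := positivity)

/-- Mertens' second theorem. -/
theorem exists_norm_sum_inv_primes_sub_le :
    ∃ M : ℂ, ∃ K : ℝ, 0 < K ∧ ∀ N : ℝ, 2 ≤ N →
      ‖∑ p ∈ Nat.primesLE ⌊N⌋₊, (1 / (p : ℂ)) - Real.log (Real.log N) - M‖ ≤ K / Real.log N := by
  obtain ⟨K, hK, hr⟩ := exists_abs_primeLogSum_sub_log_le
  set F : ℝ → ℂ := fun x => ((-(1 / (x * Real.log x ^ 2)) : ℝ) : ℂ) * primeLogError x with hF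
  have hFbd : ∀ x : ℝ, 2 ≤ x → ‖F x‖ ≤ K * (1 / (x * Real.log x ^ 2)) := fun x hx => by
    have h1 : |primeLogError x| ≤ K := hr x (by linarith)
    have h2 : 0 ≤ 1 / (x * Real.log x ^ 2) := by positivity
    rw [hF, norm_mul, Complex.norm_real, Complex.norm_real, norm_neg, Real.norm_of_nonneg h2,
      mul_comm]
    exact mul_le_mul_of_nonneg_right h1 h2
  have hFm : Measurable F := by
    refine (Complex.measurable_ofReal.comp ?_).mul
      (Complex.measurable_ofReal.comp measurable_primeLogError)
    exact ((measurable_id.mul (Real.measurable_log.pow_const 2)).const_div 1).neg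
  have hFint : ∀ a : ℝ, 2 ≤ a → IntegrableOn F (Set.Ioi a) := fun a ha => by
    refine Integrable.mono' ((integrableOn_inv_mul_log_sq ha).const_mul K)
      hFm.aestronglyMeasurable ?_
    filter_upwards [ae_restrict_mem measurableSet_Ioi] with x hx
    exact hFbd x (ha.trans (Set.mem_Ioi.mp hx).le)
  -- The 1 is the boundary term `f(2) log 2` for `f = 1/log`. Completing the error integral to
  -- infinity makes the constant independent of `N`; the tail and the boundary term at `N` each cost
  -- `K / log N`.
  refine ⟨1 - Real.log (Real.log 2) - ∫ x in Set.Ioi 2, F x, 2 * K, by positivity, fun N hN => ?_⟩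
  have hlN : 0 < Real.log N := Real.log_pos (by linarith)
  have key := sum_mul_log_div_eq (f := fun x => (((Real.log x)⁻¹ : ℝ) : ℂ))
    (f' := fun x => ((-(1 / (x * Real.log x ^ 2)) : ℝ) : ℂ)) hN
    (fun x hx => by simpa using (hasDerivAt_neg_inv_log hx.1).neg.ofReal_comp) (by
      refine Complex.continuous_ofReal.comp_continuousOn fun x hx =>
        ContinuousAt.continuousWithinAt ?_
      have h0 : x ≠ 0 := by linarith [hx.1]
      have hl : Real.log x ≠ 0 := (Real.log_pos (by linarith [hx.1])).ne'
      fun_prop (disch := positivity))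
  have e1 : ∑ p ∈ Nat.primesLE ⌊N⌋₊, (((Real.log p)⁻¹ : ℝ) : ℂ) * ((Real.log p / p : ℝ) : ℂ) =
      ∑ p ∈ Nat.primesLE ⌊N⌋₊, (1 / (p : ℂ)) := by
    refine Finset.sum_congr rfl fun p hp => ?_
    have hp1 : (1 : ℝ) < p := by exact_mod_cast (Nat.prime_of_mem_primesLE hp).one_lt
    have hl : Real.log p ≠ 0 := (Real.log_pos hp1).ne'
    rw [← Complex.ofReal_mul]
    have : (Real.log p)⁻¹ * (Real.log p / p) = 1 / p := by field_simp
    rw [this]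
    simp
  have e2 : ∫ x in (2 : ℝ)..N, (((Real.log x)⁻¹ : ℝ) : ℂ) / x =
      ((Real.log (Real.log N) - Real.log (Real.log 2) : ℝ) : ℂ) := by
    rw [← integral_inv_mul_log hN, ← intervalIntegral.integral_ofReal]
    refine intervalIntegral.integral_congr fun x _ => ?_
    push_cast
    rw [one_div, mul_inv, div_eq_mul_inv, mul_comm]
  have e3 : ∫ x in (2 : ℝ)..N, F x = (∫ x in Set.Ioi 2, F x) - ∫ x in Set.Ioi N, F x := by
    rw [intervalIntegral.integral_of_le hN, eq_sub_iff_add_eq,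
      ← setIntegral_union (Set.Ioc_disjoint_Ioi le_rfl) measurableSet_Ioi
        ((hFint 2 le_rfl).mono_set Set.Ioc_subset_Ioi_self) (hFint N hN),
      Set.Ioc_union_Ioi_eq_Ioi hN]
  have e4 : ‖∫ x in Set.Ioi N, F x‖ ≤ K / Real.log N := by
    calc ‖∫ x in Set.Ioi N, F x‖ ≤ ∫ x in Set.Ioi N, K * (1 / (x * Real.log x ^ 2)) := by
          refine norm_integral_le_of_norm_le ((integrableOn_inv_mul_log_sq hN).const_mul K) ?_
          filter_upwards [ae_restrict_mem measurableSet_Ioi] with x hx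
          exact hFbd x (hN.trans (Set.mem_Ioi.mp hx).le)
      _ = K / Real.log N := by
          rw [integral_const_mul, integral_inv_mul_log_sq hN]; ring
  have e5 : ‖(((Real.log N)⁻¹ : ℝ) : ℂ) * primeLogError N‖ ≤ K / Real.log N := by
    rw [norm_mul, Complex.norm_real, Complex.norm_real, Real.norm_of_nonneg (by positivity),
      div_eq_inv_mul]
    exact mul_le_mul_of_nonneg_left (hr N (by linarith)) (by positivity)
  have e6 : (((Real.log 2)⁻¹ : ℝ) : ℂ) * Real.log 2 = 1 := by
    rw [← Complex.ofReal_mul, inv_mul_cancel₀ (Real.log_pos (by norm_num)).ne', Complex.ofReal_one]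
  rw [e1, e2, e6] at key
  rw [key]
  change ‖_ - (∫ x in (2 : ℝ)..N, F x) - _ - _‖ ≤ _
  rw [e3]
  have : ((Real.log (Real.log N) - Real.log (Real.log 2) : ℝ) : ℂ) + 1 +
      (((Real.log N)⁻¹ : ℝ) : ℂ) * primeLogError N -
      ((∫ x in Set.Ioi 2, F x) - ∫ x in Set.Ioi N, F x) - Real.log (Real.log N) -
      (1 - Real.log (Real.log 2) - ∫ x in Set.Ioi 2, F x) =
      (((Real.log N)⁻¹ : ℝ) : ℂ) * primeLogError N + ∫ x in Set.Ioi N, F x := by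
    push_cast; ring
  rw [this]
  calc _ ≤ K / Real.log N + K / Real.log N := norm_add_le_of_le e5 e4
    _ = _ := by ring


/-! ### The oscillating prime sum -/

theorem norm_exp_I_mul_sub_one_le (x : ℝ) : ‖Complex.exp (Complex.I * x) - 1‖ ≤ |x| := by
  simpa using Real.norm_exp_I_mul_ofReal_sub_one_le (x := x)

theorem norm_dickman_integrand_le (lam v : ℝ) :
    ‖(Complex.exp (Complex.I * lam * v) - 1) / (v : ℂ)‖ ≤ |lam| := by
  rcases eq_or_ne v 0 with rfl | hv
  · simp
  have h := norm_exp_I_mul_sub_one_le (lam * v)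
  rw [norm_div, Complex.norm_real, Real.norm_eq_abs, div_le_iff₀ (abs_pos.mpr hv), ← abs_mul]
  rwa [Complex.ofReal_mul, ← mul_assoc] at h

theorem measurable_dickman_integrand (lam : ℝ) :
    Measurable fun v : ℝ => (Complex.exp (Complex.I * lam * v) - 1) / (v : ℂ) := by
  fun_prop

theorem intervalIntegrable_dickman_integrand (lam a b : ℝ) :
    IntervalIntegrable (fun v : ℝ => (Complex.exp (Complex.I * lam * v) - 1) / (v : ℂ))
      volume a b := by
  refine (intervalIntegrable_const (c := |lam|)).mono_fun
    (measurable_dickman_integrand lam).aestronglyMeasurable ?_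
  filter_upwards with v
  simpa using norm_dickman_integrand_le lam v

theorem continuousOn_dickman_integrand (lam : ℝ) :
    ContinuousOn (fun v : ℝ => (Complex.exp (Complex.I * lam * v) - 1) / (v : ℂ)) (Set.Ioi 0) := by
  intro v hv
  have hv0 : (v : ℂ) ≠ 0 := by exact_mod_cast (Set.mem_Ioi.mp hv).ne'
  refine ContinuousAt.continuousWithinAt ?_
  fun_prop (disch := assumption)

/-- The factor `(x ^ (it) - 1) / log x` by which `log p / p` is weighted. -/
noncomputable def oscWeight (t x : ℝ) : ℂ :=
  (Complex.exp (Complex.I * (t * Real.log x : ℝ)) - 1) * ((Real.log x)⁻¹ : ℝ)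

/-- The derivative of `oscWeight t`. -/
noncomputable def oscWeightDeriv (t x : ℝ) : ℂ :=
  Complex.exp (Complex.I * (t * Real.log x : ℝ)) * (Complex.I * (t * x⁻¹ : ℝ)) *
      ((Real.log x)⁻¹ : ℝ) +
    (Complex.exp (Complex.I * (t * Real.log x : ℝ)) - 1) * (-(1 / (x * Real.log x ^ 2)) : ℝ)

theorem hasDerivAt_oscWeight (t : ℝ) {x : ℝ} (hx : 2 ≤ x) :
    HasDerivAt (oscWeight t) (oscWeightDeriv t x) x := by
  have h1 : HasDerivAt (fun y : ℝ => ((t * Real.log y : ℝ) : ℂ)) (t * x⁻¹ : ℝ) x :=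
    ((Real.hasDerivAt_log (by linarith : x ≠ 0)).const_mul t).ofReal_comp
  have h2 : HasDerivAt (fun y : ℝ => (((Real.log y)⁻¹ : ℝ) : ℂ))
      (-(1 / (x * Real.log x ^ 2)) : ℝ) x := by
    simpa using (hasDerivAt_neg_inv_log hx).neg.ofReal_comp
  exact ((h1.const_mul Complex.I).cexp.sub_const 1).mul h2

theorem continuousOn_oscWeightDeriv (t b : ℝ) :
    ContinuousOn (oscWeightDeriv t) (Set.Icc 2 b) := by
  intro x hx
  refine ContinuousAt.continuousWithinAt ?_
  have h0 : x ≠ 0 := by linarith [hx.1]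
  have hl : Real.log x ≠ 0 := (Real.log_pos (by linarith [hx.1])).ne'
  unfold oscWeightDeriv
  fun_prop (disch := positivity)

theorem norm_oscWeight_le (t : ℝ) {x : ℝ} (hx : 2 ≤ x) : ‖oscWeight t x‖ ≤ |t| := by
  have hl : 0 < Real.log x := Real.log_pos (by linarith)
  have h := norm_exp_I_mul_sub_one_le (t * Real.log x)
  rw [abs_mul, abs_of_pos hl] at h
  rw [oscWeight, norm_mul, Complex.norm_real, Real.norm_of_nonneg (by positivity),
    ← div_eq_mul_inv, div_le_iff₀ hl]
  exact h

theorem norm_oscWeightDeriv_le (t : ℝ) {x : ℝ} (hx : 2 ≤ x) :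
    ‖oscWeightDeriv t x‖ ≤ 2 * |t| * (1 / (x * Real.log x)) := by
  have hl : 0 < Real.log x := Real.log_pos (by linarith)
  have hx0 : 0 < x := by linarith
  have h := norm_exp_I_mul_sub_one_le (t * Real.log x)
  rw [abs_mul, abs_of_pos hl] at h
  have h1 : ‖Complex.exp (Complex.I * (t * Real.log x : ℝ))‖ = 1 := by
    rw [mul_comm]; exact Complex.norm_exp_ofReal_mul_I _
  refine (norm_add_le _ _).trans ?_
  rw [norm_mul, norm_mul, norm_mul, norm_mul, h1, Complex.norm_I, Complex.norm_real,
    Complex.norm_real, Complex.norm_real, norm_neg,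
    Real.norm_of_nonneg (by positivity : 0 ≤ (Real.log x)⁻¹),
    Real.norm_of_nonneg (by positivity : 0 ≤ 1 / (x * Real.log x ^ 2)), norm_mul, Real.norm_eq_abs,
    Real.norm_of_nonneg (by positivity : 0 ≤ x⁻¹)]
  have h2 := mul_le_mul_of_nonneg_right h (by positivity : 0 ≤ 1 / (x * Real.log x ^ 2))
  calc _ ≤ 1 * (1 * (|t| * x⁻¹)) * (Real.log x)⁻¹ +
        |t| * Real.log x * (1 / (x * Real.log x ^ 2)) := by gcongr
    _ = _ := by field_simp; ring

/-- The substitution `v = log x / log N`. -/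
theorem integral_oscWeight_div {N : ℝ} (hN : 2 ≤ N) (lam : ℝ) :
    ∫ x in (2 : ℝ)..N, oscWeight (lam / Real.log N) x / x =
      ∫ v in (Real.log 2 / Real.log N)..1, (Complex.exp (Complex.I * lam * v) - 1) / (v : ℂ) := by
  have hlN : 0 < Real.log N := Real.log_pos (by linarith)
  have h := intervalIntegral.integral_deriv_smul_comp' (a := 2) (b := N)
    (f := fun x => Real.log x / Real.log N) (f' := fun x => x⁻¹ / Real.log N)
    (g := fun v : ℝ => (Complex.exp (Complex.I * lam * v) - 1) / (v : ℂ))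
    (fun x hx => by
      rw [Set.uIcc_of_le hN] at hx
      exact (Real.hasDerivAt_log (by linarith [hx.1])).div_const _)
    (by
      rw [Set.uIcc_of_le hN]
      intro x hx
      have h0 : x ≠ 0 := by linarith [hx.1]
      exact ((continuousAt_inv₀ h0).div_const _).continuousWithinAt)
    ((continuousOn_dickman_integrand lam).mono (by
      rw [Set.uIcc_of_le hN]
      rintro _ ⟨x, hx, rfl⟩
      exact div_pos (Real.log_pos (by linarith [hx.1])) hlN))
  rw [div_self hlN.ne'] at h
  rw [← h]
  refine intervalIntegral.integral_congr fun x hx => ?_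
  rw [Set.uIcc_of_le hN] at hx
  have hl : (Real.log x : ℂ) ≠ 0 := by
    exact_mod_cast (Real.log_pos (by linarith [hx.1])).ne'
  have hL : (Real.log N : ℂ) ≠ 0 := by exact_mod_cast hlN.ne'
  have hx0 : (x : ℂ) ≠ 0 := by exact_mod_cast (by linarith [hx.1] : x ≠ 0)
  have he : Complex.I * ((lam / Real.log N * Real.log x : ℝ) : ℂ) =
      Complex.I * lam * ((Real.log x / Real.log N : ℝ) : ℂ) := by
    push_cast; ring
  simp only [Function.comp, oscWeight, he, Complex.real_smul]
  push_cast
  field_simp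

/-- Partial summation with weight `(x^{it} - 1)/log x`, `t = λ / log N`. The weight is at most `|t|`
and its derivative at most `2|t| / (x log x)`; integrating the latter produces the factor `log log
N`. -/
theorem exists_norm_sum_oscillating_sub_le :
    ∃ K : ℝ, 0 < K ∧ ∀ N : ℝ, 2 ≤ N → ∀ lam : ℝ,
      ‖∑ p ∈ Nat.primesLE ⌊N⌋₊,
          (Complex.exp (Complex.I * (lam / Real.log N * Real.log p : ℝ)) - 1) / (p : ℂ) -
        ∫ v in (0 : ℝ)..1, (Complex.exp (Complex.I * lam * v) - 1) / (v : ℂ)‖ ≤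
      K * (|lam| * (1 + |Real.log (Real.log N)|) / Real.log N) := by
  obtain ⟨K, hK, hr⟩ := exists_abs_primeLogSum_sub_log_le
  set c := |Real.log (Real.log 2)| with hc
  -- One `log 2` pays for the missing range `0 ≤ v ≤ log 2 / log N`, the other for the boundary at
  -- 2; `K` for the boundary at `N`; the last summand for the integral of the derivative, with `c`
  -- coming from its lower limit.
  refine ⟨2 * Real.log 2 + K + 2 * K * (1 + c), by positivity, fun N hN lam => ?_⟩
  have hl2 : 0 < Real.log 2 := Real.log_pos (by norm_num)
  have hlN : 0 < Real.log N := Real.log_pos (by linarith)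
  set t := lam / Real.log N with ht
  have htabs : |t| = |lam| / Real.log N := by rw [ht, abs_div, abs_of_pos hlN]
  have key := sum_mul_log_div_eq (f := oscWeight t) (f' := oscWeightDeriv t) hN
    (fun x hx => hasDerivAt_oscWeight t hx.1) (continuousOn_oscWeightDeriv t N)
  have e1 : ∑ p ∈ Nat.primesLE ⌊N⌋₊, oscWeight t p * ((Real.log p / p : ℝ) : ℂ) =
      ∑ p ∈ Nat.primesLE ⌊N⌋₊,
        (Complex.exp (Complex.I * (t * Real.log p : ℝ)) - 1) / (p : ℂ) := by
    refine Finset.sum_congr rfl fun p hp => ?_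
    have hp1 : (1 : ℝ) < p := by exact_mod_cast (Nat.prime_of_mem_primesLE hp).one_lt
    have hl : Real.log p ≠ 0 := (Real.log_pos hp1).ne'
    rw [oscWeight, mul_assoc, ← Complex.ofReal_mul]
    have : (Real.log p)⁻¹ * (Real.log p / p) = (p : ℝ)⁻¹ := by field_simp
    rw [this, div_eq_mul_inv]
    push_cast
    rfl
  have hsplit := intervalIntegral.integral_add_adjacent_intervals
    (intervalIntegrable_dickman_integrand lam 0 (Real.log 2 / Real.log N))
    (intervalIntegrable_dickman_integrand lam (Real.log 2 / Real.log N) 1)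
  have b1 : ‖∫ v in (0 : ℝ)..(Real.log 2 / Real.log N),
      (Complex.exp (Complex.I * lam * v) - 1) / (v : ℂ)‖ ≤ Real.log 2 * |t| := by
    refine (intervalIntegral.norm_integral_le_of_norm_le_const
      fun v _ => norm_dickman_integrand_le lam v).trans ?_
    rw [sub_zero, abs_of_pos (div_pos hl2 hlN), htabs]
    apply le_of_eq
    ring
  have b2 : ‖oscWeight t 2 * (Real.log 2 : ℂ)‖ ≤ Real.log 2 * |t| := by
    rw [norm_mul, Complex.norm_real, Real.norm_of_nonneg hl2.le, mul_comm]
    exact mul_le_mul_of_nonneg_left (norm_oscWeight_le t le_rfl) hl2.le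
  have b3 : ‖oscWeight t N * (primeLogError N : ℂ)‖ ≤ K * |t| := by
    rw [norm_mul, Complex.norm_real, mul_comm]
    exact mul_le_mul (hr N (by linarith)) (norm_oscWeight_le t hN) (norm_nonneg _) hK.le
  have b4 : ‖∫ x in (2 : ℝ)..N, oscWeightDeriv t x * primeLogError x‖ ≤
      2 * K * (|Real.log (Real.log N)| + c) * |t| := by
    have hi : IntervalIntegrable (fun x => 1 / (x * Real.log x)) volume 2 N := by
      rw [intervalIntegrable_iff_integrableOn_Icc_of_le hN]
      refine ContinuousOn.integrableOn_Icc fun x hx => ContinuousAt.continuousWithinAt ?_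
      have h0 : x ≠ 0 := by linarith [hx.1]
      have hl : Real.log x ≠ 0 := (Real.log_pos (by linarith [hx.1])).ne'
      fun_prop (disch := positivity)
    calc _ ≤ ∫ x in (2 : ℝ)..N, 2 * K * |t| * (1 / (x * Real.log x)) := by
          refine intervalIntegral.norm_integral_le_of_norm_le hN ?_ (hi.const_mul _)
          filter_upwards with x hx
          rw [norm_mul, Complex.norm_real, Real.norm_eq_abs]
          calc _ ≤ 2 * |t| * (1 / (x * Real.log x)) * K :=
                mul_le_mul (norm_oscWeightDeriv_le t hx.1.le) (hr x (by linarith [hx.1]))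
                  (abs_nonneg _) (by
                    have : 0 < Real.log x := Real.log_pos (by linarith [hx.1])
                    have : 0 < x := by linarith [hx.1]
                    positivity)
            _ = _ := by ring
      _ = 2 * K * |t| * (Real.log (Real.log N) - Real.log (Real.log 2)) := by
          rw [intervalIntegral.integral_const_mul, integral_inv_mul_log hN]
      _ ≤ 2 * K * |t| * (|Real.log (Real.log N)| + c) := by
          refine mul_le_mul_of_nonneg_left ?_ (by positivity)
          linarith [le_abs_self (Real.log (Real.log N)), neg_abs_le (Real.log (Real.log 2))]
      _ = _ := by ring
  rw [← e1, key, integral_oscWeight_div hN, ← hsplit]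
  have hfin : ∀ a b x y z : ℂ, a + x + y - z - (b + a) = -b + x + y - z := fun a b x y z => by ring
  rw [hfin]
  refine (norm_sub_le_of_le (norm_add_le_of_le (norm_add_le_of_le
    ((norm_neg _).trans_le b1) b2) b3) b4).trans ?_
  set l := |Real.log (Real.log N)|
  have hl0 : 0 ≤ l := abs_nonneg _
  have hc0 : 0 ≤ c := abs_nonneg _
  have h2 : (2 * Real.log 2 + K + 2 * K * (1 + c)) * (|lam| * (1 + l) / Real.log N) =
      (2 * Real.log 2 + K + 2 * K * (1 + c)) * (1 + l) * |t| := by rw [htabs]; ring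
  rw [h2, ← add_mul, ← add_mul, ← add_mul]
  refine mul_le_mul_of_nonneg_right ?_ (abs_nonneg t)
  nlinarith [mul_nonneg hl2.le hl0, mul_nonneg hK.le hl0, mul_nonneg (mul_nonneg hK.le hl0) hc0,
    mul_nonneg hK.le hc0]


/-! ### Logarithm and size of the Euler product -/

/-- A logarithm of `(∑ j < k, w ^ j) * exp (-w)` on the unit disc. -/
noncomputable def localLog (k : ℕ) (w : ℂ) : ℂ :=
  Complex.log (1 - w ^ k) - Complex.log (1 - w) - w

theorem one_sub_mem_slitPlane {w : ℂ} (hw : ‖w‖ < 1) : 1 - w ∈ Complex.slitPlane := by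
  have := Complex.mem_slitPlane_of_norm_lt_one (z := -w) (by simpa using hw)
  simpa [sub_eq_add_neg] using this

theorem exp_add_localLog {k : ℕ} (hk : k ≠ 0) {w : ℂ} (hw : ‖w‖ < 1) :
    Complex.exp (w + localLog k w) = ∑ j ∈ Finset.range k, w ^ j := by
  have h1 : 1 - w ≠ 0 := Complex.slitPlane_ne_zero (one_sub_mem_slitPlane hw)
  have h2 : 1 - w ^ k ≠ 0 := Complex.slitPlane_ne_zero (one_sub_mem_slitPlane (by
    rw [norm_pow]; exact pow_lt_one₀ (norm_nonneg _) hw hk))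
  have h3 : w + localLog k w = Complex.log (1 - w ^ k) - Complex.log (1 - w) := by
    rw [localLog]; ring
  rw [h3, Complex.exp_sub, Complex.exp_log h2, Complex.exp_log h1, div_eq_iff h1]
  exact (geom_sum_mul_neg w k).symm

theorem localLog_zero {k : ℕ} (hk : k ≠ 0) : localLog k 0 = 0 := by
  simp [localLog, hk]

theorem hasDerivAt_localLog {k : ℕ} (hk : k ≠ 0) {w : ℂ} (hw : ‖w‖ < 1) :
    HasDerivAt (localLog k) (-(k * w ^ (k - 1)) / (1 - w ^ k) - (-1) / (1 - w) - 1) w := by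
  have h2 : ‖w ^ k‖ < 1 := by
    rw [norm_pow]; exact pow_lt_one₀ (norm_nonneg _) hw hk
  exact ((((hasDerivAt_pow k w).const_sub 1).clog (one_sub_mem_slitPlane h2)).sub
    (((hasDerivAt_id w).const_sub 1).clog (one_sub_mem_slitPlane hw))).sub (hasDerivAt_id w)

/-- As `k ≥ 2`, the derivative vanishes at 0 and is `O(s)` on the disc of radius `s`; the mean value
inequality on this convex set gives the bound. With `s = |α|/p` it saves a second factor `1/p`, both
in size and in the dependence on `t`. -/
theorem norm_localLog_sub_le {k : ℕ} (hk : 2 ≤ k) {ρ s : ℝ} (hρ : ρ < 1) (hs : s ≤ ρ) {w z : ℂ}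
    (hw : ‖w‖ ≤ s) (hz : ‖z‖ ≤ s) :
    ‖localLog k w - localLog k z‖ ≤ (k + 1) / (1 - ρ) * s * ‖w - z‖ := by
  have hs0 : 0 ≤ s := (norm_nonneg _).trans hw
  refine (convex_closedBall (0 : ℂ) s).norm_image_sub_le_of_norm_hasDerivWithin_le
    (f := localLog k) (f' := fun w => -(k * w ^ (k - 1)) / (1 - w ^ k) - (-1) / (1 - w) - 1)
    (fun x hx => (hasDerivAt_localLog (by omega) ?_).hasDerivWithinAt) (fun x hx => ?_)
    (by simpa using hz) (by simpa using hw)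
  · have : ‖x‖ ≤ s := by simpa using hx
    linarith
  · have hx : ‖x‖ ≤ s := by simpa using hx
    have hx1 : ‖x‖ ≤ 1 := by linarith
    have hρ0 : 0 < 1 - ρ := by linarith
    have hpow : ∀ j : ℕ, 1 ≤ j → ‖x ^ j‖ ≤ s := fun j hj => by
      rw [norm_pow]
      calc ‖x‖ ^ j ≤ ‖x‖ ^ 1 := pow_le_pow_of_le_one (norm_nonneg _) hx1 hj
        _ ≤ s := by simpa using hx
    have hden : ∀ j : ℕ, 1 ≤ j → 1 - ρ ≤ ‖1 - x ^ j‖ := fun j hj => by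
      have h1 := norm_sub_norm_le (1 : ℂ) (x ^ j)
      rw [norm_one] at h1
      linarith [hpow j hj]
    have hne : 1 - x ≠ 0 := by
      have h := hden 1 le_rfl
      rw [pow_one] at h
      exact norm_pos_iff.mp (by linarith)
    have e : -(k * x ^ (k - 1)) / (1 - x ^ k) - (-1) / (1 - x) - 1 =
        -(k * x ^ (k - 1)) / (1 - x ^ k) + x / (1 - x) := by
      rw [sub_sub, sub_eq_add_neg]
      congr 1
      field_simp
      ring
    rw [e]
    have b1 : ‖-(k * x ^ (k - 1)) / (1 - x ^ k)‖ ≤ k * s / (1 - ρ) := by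
      rw [norm_div, norm_neg, norm_mul, Complex.norm_natCast]
      gcongr
      · exact hpow _ (by omega)
      · exact hden k (by omega)
    have b2 : ‖x / (1 - x)‖ ≤ s / (1 - ρ) := by
      rw [norm_div]
      gcongr
      simpa using hden 1 le_rfl
    calc _ ≤ k * s / (1 - ρ) + s / (1 - ρ) := norm_add_le_of_le b1 b2
      _ = _ := by ring

theorem norm_localLog_le {k : ℕ} (hk : 2 ≤ k) {ρ : ℝ} (hρ : ρ < 1) {w : ℂ} (hw : ‖w‖ ≤ ρ) :
    ‖localLog k w‖ ≤ (k + 1) / (1 - ρ) * ‖w‖ ^ 2 := by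
  have h := norm_localLog_sub_le hk hρ hw le_rfl (z := 0) (by simp)
  rw [localLog_zero (by omega), sub_zero, sub_zero] at h
  calc _ ≤ _ := h
    _ = _ := by ring

/-- The value `α p ^ (-1 + it)`. -/
noncomputable def primeWeight (α : ℂ) (t : ℝ) (p : ℕ) : ℂ :=
  α / p * Complex.exp (Complex.I * (t * Real.log p : ℝ))

theorem norm_primeWeight (α : ℂ) (t : ℝ) (p : ℕ) : ‖primeWeight α t p‖ = ‖α‖ / p := by
  have h1 : ‖Complex.exp (Complex.I * (t * Real.log p : ℝ))‖ = 1 := by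
    rw [mul_comm]; exact Complex.norm_exp_ofReal_mul_I _
  rw [primeWeight, norm_mul, h1, norm_div, Complex.norm_natCast, mul_one]

theorem norm_primeWeight_sub_le (α : ℂ) (t : ℝ) (p : ℕ) :
    ‖primeWeight α t p - α / p‖ ≤ ‖α‖ / p * (|t| * Real.log p) := by
  have h : primeWeight α t p - α / p =
      α / p * (Complex.exp (Complex.I * (t * Real.log p : ℝ)) - 1) := by
    rw [primeWeight]; ring
  have h1 := norm_exp_I_mul_sub_one_le (t * Real.log p)
  rw [abs_mul, abs_of_nonneg (Real.log_natCast_nonneg p)] at h1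
  rw [h, norm_mul, norm_div, Complex.norm_natCast]
  exact mul_le_mul_of_nonneg_left h1 (by positivity)

/-- The Euler product of `∑ α ^ Ω(n) n ^ (-1 + it)` over `k`-free `N`-smooth numbers. -/
noncomputable def eulerProd (k : ℕ) (α : ℂ) (N t : ℝ) : ℂ :=
  ∏ p ∈ Nat.primesLE ⌊N⌋₊, ∑ j ∈ Finset.range k, primeWeight α t p ^ j

theorem div_prime_le {α : ℂ} {p : ℕ} (hp : p.Prime) : ‖α‖ / p ≤ ‖α‖ / 2 := by
  gcongr
  exact_mod_cast hp.two_le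

theorem eulerProd_eq_exp {k : ℕ} (hk : 2 ≤ k) {α : ℂ} (hα : ‖α‖ < 2) (N t : ℝ) :
    eulerProd k α N t = Complex.exp
      (∑ p ∈ Nat.primesLE ⌊N⌋₊, (primeWeight α t p + localLog k (primeWeight α t p))) := by
  rw [eulerProd, Complex.exp_sum]
  refine Finset.prod_congr rfl fun p hp => (exp_add_localLog (by omega) ?_).symm
  rw [norm_primeWeight]
  exact (div_prime_le (Nat.prime_of_mem_primesLE hp)).trans_lt (by linarith)

/-- All oscillation is discarded: the exponent is at most `|α| ∑ 1/p + O(∑ 1/p²)`. The bound is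
uniform in `t`, hence usable beyond the truncation. -/
theorem exists_norm_eulerProd_le {k : ℕ} (hk : 2 ≤ k) {α : ℂ} (hα : ‖α‖ < 2) :
    ∃ K : ℝ, 0 < K ∧ ∀ N : ℝ, 2 ≤ N → ∀ t : ℝ,
      ‖eulerProd k α N t‖ ≤ K * Real.log N ^ ‖α‖ := by
  obtain ⟨M, K, hK, hM⟩ := exists_norm_sum_inv_primes_sub_le
  set κ : ℝ := (k + 1) / (1 - ‖α‖ / 2) with hκ
  have hκ0 : 0 ≤ κ := div_nonneg (by positivity) (by linarith)
  set Q : ℝ := ∑' n : ℕ, 1 / (n : ℝ) ^ 2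
  have hQs : Summable fun n : ℕ => 1 / (n : ℝ) ^ 2 := Real.summable_one_div_nat_pow.mpr (by norm_num)
  refine ⟨Real.exp (‖α‖ * (K / Real.log 2 + ‖M‖) + κ * ‖α‖ ^ 2 * Q), Real.exp_pos _,
    fun N hN t => ?_⟩
  have hl2 : 0 < Real.log 2 := Real.log_pos (by norm_num)
  have hlN : 0 < Real.log N := Real.log_pos (by linarith)
  rw [eulerProd_eq_exp hk hα, Complex.norm_exp, Real.rpow_def_of_pos hlN, ← Real.exp_add,
    Real.exp_le_exp]
  have hinv : ∑ p ∈ Nat.primesLE ⌊N⌋₊, (1 / (p : ℝ)) ≤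
      Real.log (Real.log N) + (K / Real.log 2 + ‖M‖) := by
    have h1 : K / Real.log N ≤ K / Real.log 2 := by
      gcongr
    have h2 := (Complex.re_le_norm _).trans ((hM N hN).trans h1)
    have h3 : (∑ p ∈ Nat.primesLE ⌊N⌋₊, (1 / (p : ℂ))).re =
        ∑ p ∈ Nat.primesLE ⌊N⌋₊, (1 / (p : ℝ)) := by
      rw [Complex.re_sum]
      refine Finset.sum_congr rfl fun p _ => ?_
      rw [← Complex.ofReal_natCast, ← Complex.ofReal_one, ← Complex.ofReal_div, Complex.ofReal_re]
    rw [Complex.sub_re, Complex.sub_re, h3, Complex.ofReal_re] at h2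
    linarith [Complex.re_le_norm M]
  calc _ ≤ ‖∑ p ∈ Nat.primesLE ⌊N⌋₊, (primeWeight α t p + localLog k (primeWeight α t p))‖ :=
        Complex.re_le_norm _
    _ ≤ ∑ p ∈ Nat.primesLE ⌊N⌋₊, (‖α‖ * (1 / p) + κ * ‖α‖ ^ 2 * (1 / (p : ℝ) ^ 2)) := by
        refine norm_sum_le_of_le _ fun p hp => ?_
        have hpp := Nat.prime_of_mem_primesLE hp
        have hw := norm_primeWeight α t p
        have h1 := norm_localLog_le hk (ρ := ‖α‖ / 2) (by linarith)
          (hw.trans_le (div_prime_le hpp))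
        rw [hw] at h1
        refine (norm_add_le_of_le hw.le h1).trans_eq ?_
        rw [← hκ]; ring
    _ = ‖α‖ * ∑ p ∈ Nat.primesLE ⌊N⌋₊, (1 / (p : ℝ)) +
        κ * ‖α‖ ^ 2 * ∑ p ∈ Nat.primesLE ⌊N⌋₊, (1 / (p : ℝ) ^ 2) := by
        rw [Finset.sum_add_distrib, Finset.mul_sum, Finset.mul_sum]
    _ ≤ ‖α‖ * (Real.log (Real.log N) + (K / Real.log 2 + ‖M‖)) + κ * ‖α‖ ^ 2 * Q := by
        gcongr
        exact hQs.sum_le_tsum _ fun n _ => by positivity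
    _ = _ := by ring

/-- The error exponent has four sources: `E₁` from Mertens' second theorem, `E₂` from the
oscillating sum, `E₃` from freezing the quadratic remainders at `t = 0`, and `E₄` from extending
their sum to all primes. -/
theorem exists_eulerProd_eq {k : ℕ} (hk : 2 ≤ k) {α : ℂ} (hα : ‖α‖ < 2) :
    ∃ C : ℂ, C ≠ 0 ∧ ∃ K : ℝ, 0 < K ∧ ∀ N : ℝ, 2 ≤ N → ∀ lam : ℝ, ∃ E : ℂ,
      ‖E‖ ≤ K * ((1 + |lam|) * (1 + |Real.log (Real.log N)|) / Real.log N) ∧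
      eulerProd k α N (lam / Real.log N) =
        C * (Real.log N : ℂ) ^ α * (dickmanChar α lam * Complex.exp E) := by
  obtain ⟨M, K₁, hK₁, hM⟩ := exists_norm_sum_inv_primes_sub_le
  obtain ⟨K₂, hK₂, hosc⟩ := exists_norm_sum_oscillating_sub_le
  set κ : ℝ := (k + 1) / (1 - ‖α‖ / 2) with hκ
  have hκ0 : 0 ≤ κ := div_nonneg (by positivity) (by linarith)
  have hα2 : ‖α‖ / 2 < 1 := by linarith
  set T : ℝ := ∑' n : ℕ, Real.log n / (n : ℝ) ^ 2 with hT
  have hT0 : 0 ≤ T := tsum_nonneg fun n => by positivity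
  set g : ℕ → ℂ := fun n => if n.Prime then localLog k (α / n) else 0 with hg
  have hgbd : ∀ n : ℕ, ‖g n‖ ≤ κ * ‖α‖ ^ 2 * (1 / (n : ℝ) ^ 2) := fun n => by
    simp only [hg]
    split_ifs with hn
    · have h0 : ‖α / (n : ℂ)‖ = ‖α‖ / n := by rw [norm_div, Complex.norm_natCast]
      have h1 := norm_localLog_le hk hα2 (h0.trans_le (div_prime_le hn))
      rw [h0] at h1
      refine h1.trans_eq ?_
      rw [← hκ]; ring
    · rw [norm_zero]; positivity
  have hgs : Summable g := Summable.of_norm_bounded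
    ((Real.summable_one_div_nat_pow.mpr (by norm_num : 1 < 2)).mul_left _) hgbd
  refine ⟨Complex.exp (∑' n, g n + α * M), Complex.exp_ne_zero _,
    ‖α‖ * K₁ + ‖α‖ * K₂ + 2 * (κ * ‖α‖ ^ 2 * T) + 1, by positivity, fun N hN lam => ?_⟩
  have hlN : 0 < Real.log N := Real.log_pos (by linarith)
  set t := lam / Real.log N with ht
  have htabs : |t| = |lam| / Real.log N := by rw [ht, abs_div, abs_of_pos hlN]
  set J : ℂ := ∫ v in (0 : ℝ)..1, (Complex.exp (Complex.I * lam * v) - 1) / (v : ℂ) with hJ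
  set S := Nat.primesLE ⌊N⌋₊ with hS
  set E₁ : ℂ := ∑ p ∈ S, (1 / (p : ℂ)) - Real.log (Real.log N) - M with hE₁
  set E₂ : ℂ := ∑ p ∈ S, (Complex.exp (Complex.I * (t * Real.log p : ℝ)) - 1) / (p : ℂ) - J with hE₂
  set E₃ : ℂ := ∑ p ∈ S, (localLog k (primeWeight α t p) - localLog k (α / p)) with hE₃
  set E₄ : ℂ := ∑ p ∈ S, localLog k (α / p) - ∑' n, g n with hE₄
  have hE₃b : ‖E₃‖ ≤ κ * ‖α‖ ^ 2 * T * |t| := by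
    have h1 : ‖E₃‖ ≤ ∑ p ∈ S, κ * ‖α‖ ^ 2 * |t| * (Real.log p / (p : ℝ) ^ 2) := by
      refine norm_sum_le_of_le _ fun p hp => ?_
      have hpp := Nat.prime_of_mem_primesLE hp
      have h0 : ‖α / (p : ℂ)‖ = ‖α‖ / p := by rw [norm_div, Complex.norm_natCast]
      refine (norm_localLog_sub_le hk hα2 (div_prime_le hpp) (norm_primeWeight α t p).le
        h0.le).trans ?_
      rw [← hκ]
      calc _ ≤ κ * (‖α‖ / p) * (‖α‖ / p * (|t| * Real.log p)) := by
            gcongr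
            exact norm_primeWeight_sub_le α t p
        _ = _ := by ring
    rw [← Finset.mul_sum] at h1
    refine h1.trans ?_
    calc _ ≤ κ * ‖α‖ ^ 2 * |t| * T := by
          gcongr
          exact summable_log_div_sq.sum_le_tsum _ fun n _ => by positivity
      _ = _ := by ring
  have hE₄b : ‖E₄‖ ≤ κ * ‖α‖ ^ 2 * T / Real.log N := by
    have e1 : ∑ p ∈ S, localLog k (α / p) = ∑' n, if n ∈ S then g n else 0 := by
      rw [tsum_eq_sum (s := S) (fun n hn => by simp [hn])]
      refine Finset.sum_congr rfl fun p hp => ?_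
      simp [hg, hp, Nat.prime_of_mem_primesLE hp]
    have s1 : Summable fun n => if n ∈ S then g n else 0 :=
      summable_of_ne_finset_zero (s := S) (fun n hn => by simp [hn])
    rw [hE₄, e1, ← s1.tsum_sub hgs]
    have s2 : HasSum (fun n : ℕ => κ * ‖α‖ ^ 2 / Real.log N * (Real.log n / (n : ℝ) ^ 2))
        (κ * ‖α‖ ^ 2 / Real.log N * T) := summable_log_div_sq.hasSum.mul_left _
    refine (tsum_of_norm_bounded s2 fun n => ?_).trans_eq (by ring)
    split_ifs with hn
    · rw [sub_self, norm_zero]; positivity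
    · rw [zero_sub, norm_neg]
      by_cases hp : n.Prime
      · refine (hgbd n).trans ?_
        have hNn : N < n := by
          by_contra! h
          exact hn (Nat.mem_primesLE.mpr ⟨Nat.le_floor h, hp⟩)
        -- Inserting this factor for `n > N` converts convergence of `∑ log n / n²` into the tail
        -- bound `O(1 / log N)`.
        have h2 : 1 ≤ Real.log n / Real.log N :=
          (one_le_div hlN).mpr (Real.log_le_log (by linarith) hNn.le)
        calc _ ≤ κ * ‖α‖ ^ 2 * (1 / (n : ℝ) ^ 2) * (Real.log n / Real.log N) :=
              le_mul_of_one_le_right (by positivity) h2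
          _ = _ := by ring
      · simp only [hg, hp, if_false, norm_zero]; positivity
  have hE₁b : ‖E₁‖ ≤ K₁ / Real.log N := hM N hN
  have hE₂b := hosc N hN lam
  refine ⟨α * E₁ + α * E₂ + E₃ + E₄, ?_, ?_⟩
  · have hl0 : 0 ≤ |Real.log (Real.log N)| := abs_nonneg _
    set X := (1 + |lam|) * (1 + |Real.log (Real.log N)|) / Real.log N with hX
    have x1 : 1 / Real.log N ≤ X := by
      rw [hX]; gcongr; nlinarith [abs_nonneg lam]
    have x2 : |t| ≤ X := by
      rw [htabs, hX]; gcongr; nlinarith [abs_nonneg lam]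
    have x3 : |lam| * (1 + |Real.log (Real.log N)|) / Real.log N ≤ X := by
      rw [hX]; gcongr; linarith
    have x0 : 0 ≤ X := by positivity
    have n1 : ‖α * E₁‖ ≤ ‖α‖ * (K₁ * X) := by
      rw [norm_mul]; gcongr
      refine hE₁b.trans ?_
      rw [div_eq_mul_one_div]; gcongr
    have n2 : ‖α * E₂‖ ≤ ‖α‖ * (K₂ * X) := by
      rw [norm_mul]; gcongr
      refine hE₂b.trans ?_
      gcongr
    have n3 : ‖E₃‖ ≤ κ * ‖α‖ ^ 2 * T * X := hE₃b.trans (by gcongr)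
    have n4 : ‖E₄‖ ≤ κ * ‖α‖ ^ 2 * T * X := hE₄b.trans (by
      rw [div_eq_mul_one_div]; gcongr)
    refine (norm_add_le_of_le (norm_add_le_of_le (norm_add_le_of_le n1 n2) n3) n4).trans ?_
    linarith
  · have hlogN : (Real.log N : ℂ) ≠ 0 := by exact_mod_cast hlN.ne'
    rw [eulerProd_eq_exp hk hα, dickmanChar, ← hJ, Complex.cpow_def_of_ne_zero hlogN,
      ← Complex.ofReal_log hlN.le, ← Complex.exp_add, ← Complex.exp_add, ← Complex.exp_add]
    congr 1
    rw [Finset.sum_add_distrib]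
    have e1 : ∑ p ∈ S, primeWeight α t p = α * ∑ p ∈ S, (1 / (p : ℂ)) +
        α * ∑ p ∈ S, (Complex.exp (Complex.I * (t * Real.log p : ℝ)) - 1) / (p : ℂ) := by
      rw [Finset.mul_sum, Finset.mul_sum, ← Finset.sum_add_distrib]
      refine Finset.sum_congr rfl fun p _ => ?_
      rw [primeWeight]; ring
    rw [e1, hE₁, hE₂, hE₃, hE₄, Finset.sum_sub_distrib]
    ring


/-! ### The sum over k-free smooth numbers as an Euler product -/

theorem kFree_prime_pow_iff {k : ℕ} (hk : k ≠ 0) {q j : ℕ} (hq : q.Prime) :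
    (∀ p : ℕ, p.Prime → ¬ p ^ k ∣ q ^ j) ↔ j < k := by
  constructor
  · intro h
    by_contra! hkj
    exact h q hq (pow_dvd_pow q hkj)
  · intro hjk p hp hdvd
    have hpq : p ∣ q := hp.dvd_of_dvd_pow ((dvd_pow_self p hk).trans hdvd)
    rw [(Nat.prime_dvd_prime_iff_eq hp hq).mp hpq, Nat.pow_dvd_pow_iff_le_right hq.one_lt] at hdvd
    omega

theorem kFree_mul_iff {k : ℕ} (hk : k ≠ 0) {m n : ℕ} (hmn : m.Coprime n) :
    (∀ p : ℕ, p.Prime → ¬ p ^ k ∣ m * n) ↔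
      (∀ p : ℕ, p.Prime → ¬ p ^ k ∣ m) ∧ ∀ p : ℕ, p.Prime → ¬ p ^ k ∣ n := by
  have h : ∀ p : ℕ, p.Prime → (p ^ k ∣ m * n ↔ p ^ k ∣ m ∨ p ^ k ∣ n) := fun p hp =>
    hmn.isPrimePow_dvd_mul (hp.isPrimePow.pow hk)
  constructor
  · intro H
    exact ⟨fun p hp hd => H p hp ((h p hp).mpr (Or.inl hd)),
      fun p hp hd => H p hp ((h p hp).mpr (Or.inr hd))⟩
  · rintro ⟨h1, h2⟩ p hp hd
    rcases (h p hp).mp hd with hd | hd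
    exacts [h1 p hp hd, h2 p hp hd]

/-- The summand `α ^ Ω(n) n ^ (-1 + it)`. -/
noncomputable def omegaTerm (α : ℂ) (t : ℝ) (n : ℕ) : ℂ :=
  Complex.exp (Complex.I * (t * Real.log n : ℝ)) *
    (α ^ ArithmeticFunction.cardFactors n / (n : ℂ))

open Classical in
/-- The summand `α ^ Ω(n) n ^ (-1 + it)` restricted to `k`-free numbers. -/
noncomputable def kFreeTerm (k : ℕ) (α : ℂ) (t : ℝ) (n : ℕ) : ℂ :=
  if ∀ p : ℕ, p.Prime → ¬ p ^ k ∣ n then omegaTerm α t n else 0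

theorem omegaTerm_mul (α : ℂ) (t : ℝ) {m n : ℕ} (hm : m ≠ 0) (hn : n ≠ 0) :
    omegaTerm α t (m * n) = omegaTerm α t m * omegaTerm α t n := by
  have hlog : Real.log ((m * n : ℕ) : ℝ) = Real.log m + Real.log n := by
    rw [Nat.cast_mul, Real.log_mul (by exact_mod_cast hm) (by exact_mod_cast hn)]
  simp only [omegaTerm]
  rw [hlog, ArithmeticFunction.cardFactors_mul hm hn, mul_add, Complex.ofReal_add, mul_add,
    Complex.exp_add, pow_add, Nat.cast_mul, mul_div_mul_comm]
  ring

theorem omegaTerm_zero (α : ℂ) (t : ℝ) : omegaTerm α t 0 = 0 := by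
  simp [omegaTerm]

theorem kFreeTerm_zero (k : ℕ) (α : ℂ) (t : ℝ) : kFreeTerm k α t 0 = 0 := by
  rw [kFreeTerm, omegaTerm_zero, ite_self]

theorem kFreeTerm_one {k : ℕ} (hk : k ≠ 0) (α : ℂ) (t : ℝ) : kFreeTerm k α t 1 = 1 := by
  have : ∀ p : ℕ, p.Prime → ¬ p ^ k ∣ 1 := fun p hp hd =>
    hp.one_lt.ne' (by simpa [hk] using hd)
  rw [kFreeTerm, if_pos this]
  simp [omegaTerm]

theorem kFreeTerm_mul {k : ℕ} (hk : k ≠ 0) (α : ℂ) (t : ℝ) {m n : ℕ} (hmn : m.Coprime n) :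
    kFreeTerm k α t (m * n) = kFreeTerm k α t m * kFreeTerm k α t n := by
  rcases eq_or_ne m 0 with rfl | hm
  · rw [zero_mul, kFreeTerm_zero, zero_mul]
  rcases eq_or_ne n 0 with rfl | hn
  · rw [mul_zero, kFreeTerm_zero, mul_zero]
  have h := kFree_mul_iff hk hmn
  by_cases h1 : ∀ p : ℕ, p.Prime → ¬ p ^ k ∣ m
  · by_cases h2 : ∀ p : ℕ, p.Prime → ¬ p ^ k ∣ n
    · rw [kFreeTerm, kFreeTerm, kFreeTerm, if_pos h1, if_pos h2, if_pos (h.mpr ⟨h1, h2⟩),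
        omegaTerm_mul α t hm hn]
    · rw [kFreeTerm, if_neg (fun h3 => h2 (h.mp h3).2), kFreeTerm.eq_1 k α t n, if_neg h2, mul_zero]
  · rw [kFreeTerm, if_neg (fun h3 => h1 (h.mp h3).1), kFreeTerm.eq_1 k α t m, if_neg h1, zero_mul]

theorem omegaTerm_prime_pow (α : ℂ) (t : ℝ) {p : ℕ} (hp : p.Prime) (j : ℕ) :
    omegaTerm α t (p ^ j) = primeWeight α t p ^ j := by
  rw [omegaTerm, primeWeight, ArithmeticFunction.cardFactors_apply_prime_pow hp, mul_pow, div_pow,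
    ← Complex.exp_nat_mul, Nat.cast_pow, Nat.cast_pow, Real.log_pow, mul_comm]
  congr 2
  push_cast
  ring

theorem kFreeTerm_prime_pow {k : ℕ} (hk : k ≠ 0) (α : ℂ) (t : ℝ) {p : ℕ} (hp : p.Prime) (j : ℕ) :
    kFreeTerm k α t (p ^ j) = if j < k then primeWeight α t p ^ j else 0 := by
  by_cases hj : j < k
  · rw [kFreeTerm, if_pos ((kFree_prime_pow_iff hk hp).mpr hj), if_pos hj,
      omegaTerm_prime_pow α t hp]
  · rw [kFreeTerm, if_neg (fun h => hj ((kFree_prime_pow_iff hk hp).mp h)), if_neg hj]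

theorem mem_smoothKFree_iff {k : ℕ} {N : ℝ} {n : ℕ} :
    n ∈ smoothKFree k N ↔
      (∀ p : ℕ, p.Prime → ¬ p ^ k ∣ n) ∧ n ∈ Nat.smoothNumbers (⌊N⌋₊ + 1) := by
  constructor
  · rintro ⟨h1, h2⟩
    have hn0 : n ≠ 0 := by
      rintro rfl
      exact h1 2 Nat.prime_two (dvd_zero _)
    refine ⟨h1, Nat.mem_smoothNumbers.mpr ⟨hn0, fun p hp => ?_⟩⟩
    obtain ⟨hp, hpn⟩ := (Nat.mem_primeFactorsList hn0).mp hp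
    exact Nat.lt_succ_of_le (Nat.le_floor (h2 p hp hpn))
  · rintro ⟨h1, h2⟩
    refine ⟨h1, fun p hp hpn => ?_⟩
    have hn0 := (Nat.mem_smoothNumbers.mp h2).1
    have := (Nat.mem_smoothNumbers.mp h2).2 p ((Nat.mem_primeFactorsList hn0).mpr ⟨hp, hpn⟩)
    exact (Nat.le_floor_iff' hp.ne_zero).mp (Nat.lt_succ_iff.mp this)

/-- The term is multiplicative on coprime arguments and vanishes at `p^j` for `j ≥ k`, so every
local series is a finite geometric sum. -/
theorem hasSum_kFreeTerm {k : ℕ} (hk : k ≠ 0) (α : ℂ) (N t : ℝ) :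
    HasSum (fun n : Nat.smoothNumbers (⌊N⌋₊ + 1) => kFreeTerm k α t n) (eulerProd k α N t) := by
  have htsum : ∀ p : ℕ, p.Prime → ∑' j : ℕ, kFreeTerm k α t (p ^ j) =
      ∑ j ∈ Finset.range k, primeWeight α t p ^ j := fun p hp => by
    rw [tsum_eq_sum (s := Finset.range k) (fun j hj => by
      rw [kFreeTerm_prime_pow hk α t hp, if_neg (by simpa using hj)])]
    refine Finset.sum_congr rfl fun j hj => ?_
    rw [kFreeTerm_prime_pow hk α t hp, if_pos (by simpa using hj)]
  have hsummable : ∀ {p : ℕ}, p.Prime → Summable fun j : ℕ => ‖kFreeTerm k α t (p ^ j)‖ :=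
    fun {p} hp => summable_of_ne_finset_zero (s := Finset.range k) fun j hj => by
      rw [kFreeTerm_prime_pow hk α t hp, if_neg (by simpa using hj), norm_zero]
  have hsum := (EulerProduct.summable_and_hasSum_smoothNumbers_prod_primesBelow_tsum
    (f := kFreeTerm k α t) (kFreeTerm_one hk α t) (kFreeTerm_mul hk α t) hsummable (⌊N⌋₊ + 1)).2
  have hprod : ∏ p ∈ (⌊N⌋₊ + 1).primesBelow, ∑' j : ℕ, kFreeTerm k α t (p ^ j) =
      eulerProd k α N t := by
    rw [eulerProd, Nat.primesLE]
    exact Finset.prod_congr rfl fun p hp => htsum p (Nat.prime_of_mem_primesBelow hp)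
  rwa [hprod] at hsum

theorem sum_smoothKFree_eq_eulerProd {k : ℕ} (hk : k ≠ 0) (α : ℂ) (N t : ℝ) :
    ∑ n ∈ (smoothKFree_finite k N).toFinset, omegaTerm α t n = eulerProd k α N t := by
  have hsum : HasSum ((Nat.smoothNumbers (⌊N⌋₊ + 1)).indicator (kFreeTerm k α t))
      (eulerProd k α N t) :=
    (hasSum_subtype_iff_indicator (f := kFreeTerm k α t)).mp (hasSum_kFreeTerm hk α N t)
  have hval : ∀ n, (Nat.smoothNumbers (⌊N⌋₊ + 1)).indicator (kFreeTerm k α t) n =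
      (smoothKFree k N).indicator (omegaTerm α t) n := fun n => by
    by_cases hn : n ∈ smoothKFree k N
    · obtain ⟨h1, h2⟩ := mem_smoothKFree_iff.mp hn
      rw [Set.indicator_of_mem hn, Set.indicator_of_mem h2, kFreeTerm, if_pos h1]
    · rw [Set.indicator_of_notMem hn]
      by_cases h2 : n ∈ Nat.smoothNumbers (⌊N⌋₊ + 1)
      · rw [Set.indicator_of_mem h2, kFreeTerm,
          if_neg fun h1 => hn (mem_smoothKFree_iff.mpr ⟨h1, h2⟩)]
      · rw [Set.indicator_of_notMem h2]
  have hfin : HasSum ((smoothKFree k N).indicator (omegaTerm α t))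
      (∑ n ∈ (smoothKFree_finite k N).toFinset, (smoothKFree k N).indicator (omegaTerm α t) n) :=
    hasSum_sum_of_ne_finset_zero fun n hn =>
      Set.indicator_of_notMem (fun h => hn ((Set.Finite.mem_toFinset _).mpr h)) _
  rw [funext hval] at hsum
  rw [hsum.unique hfin]
  exact Finset.sum_congr rfl fun n hn =>
    (Set.indicator_of_mem ((Set.Finite.mem_toFinset _).mp hn) _).symm

/-! ### Fourier inversion for distributional transforms -/

/-- Testing against a bump function equal to 1 on a ball shows measurability on that ball, and
countably many balls cover the line. -/
theorem aestronglyMeasurable_of_isFourierTransform {f g : ℝ → ℂ} (h : IsFourierTransform f g) :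
    AEStronglyMeasurable g volume := by
  have hball : ∀ n : ℕ, AEStronglyMeasurable g (volume.restrict (Metric.closedBall (0 : ℝ) (n + 1))) := by
    intro n
    let b : ContDiffBump (0 : ℝ) := ⟨n + 1, n + 2, by positivity, by linarith⟩
    have hs : ContDiff ℝ ((⊤ : ℕ∞) : WithTop ℕ∞) (fun x => (b x : ℂ)) :=
      Complex.ofRealCLM.contDiff.comp b.contDiff
    have hc : HasCompactSupport (fun x => (b x : ℂ)) :=
      b.hasCompactSupport.comp_left (g := fun x : ℝ => (x : ℂ)) Complex.ofReal_zero
    have h1 := (h (hc.toSchwartzMap hs)).1.aestronglyMeasurable.restrict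
      (s := Metric.closedBall (0 : ℝ) (n + 1))
    refine h1.congr ?_
    filter_upwards [ae_restrict_mem Metric.isClosed_closedBall.measurableSet] with x hx
    have : b x = 1 := b.one_of_mem_closedBall hx
    simp [this]
  have hU : ⋃ n : ℕ, Metric.closedBall (0 : ℝ) (n + 1) = Set.univ := by
    refine Set.eq_univ_of_forall fun x => Set.mem_iUnion.mpr ?_
    obtain ⟨n, hn⟩ := exists_nat_ge ‖x‖
    exact ⟨n, by rw [mem_closedBall_zero_iff]; linarith⟩
  rw [← Measure.restrict_univ (μ := (volume : Measure ℝ)), ← hU]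
  exact aestronglyMeasurable_iUnion_iff.mpr hball

theorem norm_exp_I_mul_mul (x y : ℝ) : ‖Complex.exp (Complex.I * x * y)‖ = 1 := by
  have : Complex.I * x * y = ((x * y : ℝ) : ℂ) * Complex.I := by push_cast; ring
  rw [this, Complex.norm_exp_ofReal_mul_I]

/-- Fourier inversion for a continuous function with integrable distributional Fourier
transform. -/
theorem eq_integral_of_isFourierTransform {f g : ℝ → ℂ} (hf : Continuous f)
    (hg : Integrable g) (h : IsFourierTransform f g) (x : ℝ) :
    f x = ∫ lam : ℝ, g lam * Complex.exp (Complex.I * lam * x) := by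
  set F : ℝ → ℂ := fun x => ∫ lam : ℝ, g lam * Complex.exp (Complex.I * lam * x) with hF
  have hFc : Continuous F := by
    refine continuous_of_dominated (bound := fun lam => ‖g lam‖) (fun x => ?_) (fun x => ?_) hg.norm ?_
    · exact hg.aestronglyMeasurable.mul (by fun_prop : Continuous _).aestronglyMeasurable
    · filter_upwards with lam
      rw [norm_mul, norm_exp_I_mul_mul, mul_one]
    · filter_upwards with lam
      fun_prop
  -- Both sides are continuous, so it is enough to test them against smooth compactly supported `χ`.
  -- Writing `χ` as the transform of a Schwartz function `ψ` moves the pairing to `∫ g ψ`, and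
  -- Fubini brings it back to `∫ χ F`.
  suffices hae : f =ᵐ[volume] F from congrFun (Continuous.ae_eq_iff_eq volume hf hFc |>.mp hae) x
  refine ae_eq_of_integral_contDiff_smul_eq hf.locallyIntegrable hFc.locallyIntegrable
    fun χ hχ hχc => ?_
  have hpi : (2 * Real.pi) ≠ 0 := by positivity
  -- The rescaling translates between kernels: `fourierTransform ψ x` is `𝓕 ψ (x / 2π) / 2π`, so `𝓕
  -- ψ` has to be `2π χ(2π y)`.
  set θ : ℝ → ℂ := fun y => ((2 * Real.pi * χ (2 * Real.pi * y) : ℝ) : ℂ) with hθ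
  have hθs : ContDiff ℝ ((⊤ : ℕ∞) : WithTop ℕ∞) θ := by
    refine Complex.ofRealCLM.contDiff.comp (contDiff_const.mul (hχ.comp ?_))
    exact contDiff_const.mul contDiff_id
  have hθc : HasCompactSupport θ := by
    have h1 : HasCompactSupport (fun y => χ (2 * Real.pi * y)) :=
      hχc.comp_homeomorph (Homeomorph.mulLeft₀ (2 * Real.pi) hpi)
    exact h1.comp_left (g := fun z : ℝ => ((2 * Real.pi * z : ℝ) : ℂ)) (by simp)
  set Θ := hθc.toSchwartzMap hθs
  have hΘ : ∀ y, Θ y = θ y := fun y => rfl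
  set ψ := 𝓕⁻ Θ with hψ
  have hψF : 𝓕 ψ = Θ := FourierInvPair.fourier_fourierInv_eq Θ
  have hft : ∀ x, fourierTransform ψ x = χ x := fun x => by
    have h1 : (𝓕 (ψ : ℝ → ℂ)) (x / (2 * Real.pi)) = θ (x / (2 * Real.pi)) := by
      rw [← SchwartzMap.fourier_coe, hψF, hΘ]
    rw [Real.fourier_real_eq_integral_exp_smul] at h1
    have h2 : ∫ v : ℝ, Complex.exp (-(Complex.I * x * v)) * ψ v = θ (x / (2 * Real.pi)) := by
      rw [← h1]
      congr 1
      ext v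
      rw [smul_eq_mul]
      congr 2
      push_cast
      have : (Real.pi : ℂ) ≠ 0 := by exact_mod_cast Real.pi_ne_zero
      field_simp
    rw [fourierTransform, h2, hθ]
    simp only
    rw [mul_div_cancel₀ _ hpi]
    have : (Real.pi : ℂ) ≠ 0 := by exact_mod_cast Real.pi_ne_zero
    push_cast
    field_simp
  have hψv : ∀ lam, ψ lam = ∫ x : ℝ, Complex.exp (Complex.I * lam * x) * χ x := fun lam => by
    have h1 : ψ lam = 𝓕⁻ (Θ : ℝ → ℂ) lam := by rw [hψ, SchwartzMap.fourierInv_coe]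
    rw [h1, Real.fourierInv_eq']
    have h2 := Measure.integral_comp_mul_left
      (fun x : ℝ => Complex.exp (Complex.I * lam * x) * (χ x : ℂ)) (2 * Real.pi)
    rw [abs_inv, abs_of_pos (by positivity : 0 < 2 * Real.pi)] at h2
    have h3 : ∫ x : ℝ, Complex.exp (Complex.I * lam * x) * χ x =
        (2 * Real.pi) • ∫ x : ℝ, Complex.exp (Complex.I * lam * (2 * Real.pi * x : ℝ)) *
          (χ (2 * Real.pi * x) : ℂ) := by
      rw [h2, smul_inv_smul₀ hpi]
    rw [h3, ← integral_smul]
    congr 1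
    ext v
    rw [hΘ, hθ, smul_eq_mul, Complex.real_smul]
    simp only [RCLike.inner_apply, conj_trivial]
    have e : ((2 * Real.pi * (lam * v) : ℝ) : ℂ) * Complex.I =
        Complex.I * lam * (2 * Real.pi * v : ℝ) := by push_cast; ring
    rw [e]
    push_cast
    ring
  have hχi : Integrable (fun x => (χ x : ℂ)) :=
    (hχ.continuous.integrable_of_hasCompactSupport hχc).ofReal
  have hprod : Integrable (fun z : ℝ × ℝ =>
      g z.1 * χ z.2 * Complex.exp (Complex.I * z.1 * z.2)) (volume.prod volume) := by
    refine (hg.mul_prod hχi).mul_bdd (c := 1)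
      (by fun_prop : Continuous _).aestronglyMeasurable ?_
    filter_upwards with z
    rw [norm_exp_I_mul_mul]
  have hmain := (h ψ).2
  calc ∫ x, χ x • f x = ∫ x, f x * fourierTransform ψ x := by
        congr 1
        ext x
        rw [hft, Complex.real_smul, mul_comm]
    _ = ∫ lam, g lam * ψ lam := hmain.symm
    _ = ∫ lam, ∫ x, g lam * χ x * Complex.exp (Complex.I * lam * x) := by
        congr 1
        ext lam
        rw [hψv, ← integral_const_mul]
        congr 1
        ext x
        ring
    _ = ∫ x, ∫ lam, g lam * χ x * Complex.exp (Complex.I * lam * x) :=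
        integral_integral_swap hprod
    _ = ∫ x, χ x • F x := by
        congr 1
        ext x
        rw [Complex.real_smul, hF, ← integral_const_mul]
        congr 1
        ext lam
        ring


/-! ### Continuity and decay of the characteristic function -/

/-- The exponent `∫ (e ^ (iλv) - 1) / v` over `0 ≤ v ≤ 1`. -/
noncomputable def dickmanExponent (lam : ℝ) : ℂ :=
  ∫ v in (0 : ℝ)..1, (Complex.exp (Complex.I * lam * v) - 1) / (v : ℂ)

/-- The integrands at `λ` and `μ` differ by a unimodular factor times the integrand at `λ - μ`, so
the exponent is 1-Lipschitz. -/
theorem continuous_dickmanExponent : Continuous dickmanExponent := by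
  refine (LipschitzWith.of_dist_le_mul (K := 1) fun lam mu => ?_).continuous
  rw [dist_eq_norm, NNReal.coe_one, one_mul, Real.dist_eq, dickmanExponent, dickmanExponent,
    ← intervalIntegral.integral_sub (intervalIntegrable_dickman_integrand _ _ _)
      (intervalIntegrable_dickman_integrand _ _ _)]
  refine (intervalIntegral.norm_integral_le_of_norm_le_const (C := |lam - mu|) fun v _ => ?_).trans
    (by simp)
  have e : (Complex.exp (Complex.I * lam * v) - 1) / (v : ℂ) -
      (Complex.exp (Complex.I * mu * v) - 1) / (v : ℂ) =
      Complex.exp (Complex.I * mu * v) *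
        ((Complex.exp (Complex.I * (lam - mu : ℝ) * v) - 1) / (v : ℂ)) := by
    have : Complex.exp (Complex.I * lam * v) = Complex.exp (Complex.I * mu * v) *
        Complex.exp (Complex.I * (lam - mu : ℝ) * v) := by
      rw [← Complex.exp_add]; congr 1; push_cast; ring
    rw [this]; ring
  rw [e, norm_mul, norm_exp_I_mul_mul, one_mul]
  exact norm_dickman_integrand_le _ v

theorem continuous_dickmanChar (α : ℂ) : Continuous (dickmanChar α) :=
  Complex.continuous_exp.comp (continuous_const.mul continuous_dickmanExponent)

theorem integral_inv_sq {a : ℝ} (ha : 0 < a) (ha1 : a ≤ 1) :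
    ∫ v in a..1, 1 / v ^ 2 = 1 / a - 1 := by
  have h := intervalIntegral.integral_eq_sub_of_hasDerivAt (a := a) (b := 1)
    (f := fun v => -v⁻¹) (f' := fun v => 1 / v ^ 2) (fun v hv => by
      rw [Set.uIcc_of_le ha1] at hv
      simpa using (hasDerivAt_inv (by linarith [hv.1] : v ≠ 0)).fun_neg) (by
      rw [intervalIntegrable_iff_integrableOn_Icc_of_le ha1]
      refine ContinuousOn.integrableOn_Icc fun v hv => ContinuousAt.continuousWithinAt ?_
      have : v ≠ 0 := by linarith [hv.1]
      fun_prop (disch := positivity))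
  rw [h]
  simp
  ring

/-- Integration by parts: each boundary term and the remaining integral of `1 / (|λ| v²)` is at most
1. -/
theorem norm_integral_exp_div_le {lam : ℝ} (hlam : 1 ≤ |lam|) :
    ‖∫ v in (1 / |lam|)..1, Complex.exp (Complex.I * lam * v) / (v : ℂ)‖ ≤ 3 := by
  have hl0 : 0 < |lam| := by linarith
  have hlne : (lam : ℂ) ≠ 0 := by exact_mod_cast abs_pos.mp hl0
  set a := 1 / |lam| with ha
  have ha0 : 0 < a := by positivity
  have ha1 : a ≤ 1 := (div_le_one hl0).mpr hlam
  have hIl : Complex.I * lam ≠ 0 := mul_ne_zero Complex.I_ne_zero hlne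
  have hIln : ‖Complex.I * (lam : ℂ)‖ = |lam| := by simp
  have hne : ∀ v ∈ Set.Icc a 1, v ≠ 0 := fun v hv => by linarith [hv.1]
  have parts := intervalIntegral.integral_mul_deriv_eq_deriv_mul (a := a) (b := 1)
    (u := fun v : ℝ => ((v⁻¹ : ℝ) : ℂ)) (u' := fun v : ℝ => ((-(1 / v ^ 2) : ℝ) : ℂ))
    (v := fun v : ℝ => Complex.exp (Complex.I * lam * v) / (Complex.I * lam))
    (v' := fun v : ℝ => Complex.exp (Complex.I * lam * v))
    (fun v hv => by
      rw [Set.uIcc_of_le ha1] at hv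
      simpa using (hasDerivAt_inv (hne v hv)).ofReal_comp)
    (fun v hv => by
      have h1 : HasDerivAt (fun v : ℝ => Complex.I * lam * (v : ℂ)) (Complex.I * lam) v := by
        simpa using (HasDerivAt.ofReal_comp (hasDerivAt_id v)).const_mul (Complex.I * (lam : ℂ))
      have h2 := h1.cexp.div_const (Complex.I * lam)
      rwa [mul_div_cancel_right₀ _ hIl] at h2)
    (by
      rw [intervalIntegrable_iff_integrableOn_Icc_of_le ha1]
      refine ContinuousOn.integrableOn_Icc fun v hv => ContinuousAt.continuousWithinAt ?_
      have := hne v hv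
      fun_prop (disch := positivity))
    (by
      refine Continuous.intervalIntegrable ?_ _ _
      fun_prop)
  have e : ∫ v in a..1, Complex.exp (Complex.I * lam * v) / (v : ℂ) =
      ∫ v in a..1, ((v⁻¹ : ℝ) : ℂ) * Complex.exp (Complex.I * lam * v) := by
    congr 1
    ext v
    push_cast
    rw [div_eq_mul_inv, mul_comm]
  have hn : ∀ v : ℝ, ‖Complex.exp (Complex.I * lam * v) / (Complex.I * lam)‖ = a := fun v => by
    rw [norm_div, norm_exp_I_mul_mul, hIln]
  have b1 : ‖(((1 : ℝ)⁻¹ : ℝ) : ℂ) *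
      (Complex.exp (Complex.I * lam * (1 : ℝ)) / (Complex.I * lam))‖ ≤ 1 := by
    rw [norm_mul, hn]; simpa using ha1
  have b2 : ‖((a⁻¹ : ℝ) : ℂ) *
      (Complex.exp (Complex.I * lam * a) / (Complex.I * lam))‖ ≤ 1 := by
    rw [norm_mul, hn, Complex.norm_real, Real.norm_of_nonneg (by positivity),
      inv_mul_cancel₀ ha0.ne']
  have b3 : ‖∫ v in a..1, ((-(1 / v ^ 2) : ℝ) : ℂ) *
      (Complex.exp (Complex.I * lam * v) / (Complex.I * lam))‖ ≤ 1 := by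
    calc _ ≤ ∫ v in a..1, a * (1 / v ^ 2) := by
          refine intervalIntegral.norm_integral_le_of_norm_le ha1 ?_ ?_
          · filter_upwards with v hv
            rw [norm_mul, hn, Complex.norm_real, norm_neg, Real.norm_of_nonneg (by positivity),
              mul_comm]
          · rw [intervalIntegrable_iff_integrableOn_Icc_of_le ha1]
            refine ContinuousOn.integrableOn_Icc fun v hv => ContinuousAt.continuousWithinAt ?_
            have := hne v hv
            fun_prop (disch := positivity)
      _ = 1 - a := by
          rw [intervalIntegral.integral_const_mul, integral_inv_sq ha0 ha1]
          field_simp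
      _ ≤ 1 := by linarith
  rw [e, parts]
  refine (norm_sub_le_of_le (norm_sub_le_of_le b1 b2) b3).trans (by norm_num)

/-- For `|λ| ≥ 1` split at `v = 1/|λ|`: below it the integrand is at most `|λ|`; above it
`e^{iλv}/v` contributes a bounded amount and `-1/v` contributes `-log |λ|`. -/
theorem norm_dickmanExponent_add_log_le (lam : ℝ) :
    ‖dickmanExponent lam + Real.log (1 + |lam|)‖ ≤ 5 := by
  have hl := abs_nonneg lam
  have hlog0 : 0 ≤ Real.log (1 + |lam|) := Real.log_nonneg (by linarith)
  rcases le_total |lam| 1 with h | h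
  · have b1 : ‖dickmanExponent lam‖ ≤ 1 := by
      refine (intervalIntegral.norm_integral_le_of_norm_le_const
        fun v _ => norm_dickman_integrand_le lam v).trans ?_
      simpa using h
    have b2 : ‖(Real.log (1 + |lam|) : ℂ)‖ ≤ 1 := by
      rw [Complex.norm_real, Real.norm_of_nonneg hlog0]
      linarith [Real.log_le_sub_one_of_pos (by linarith : 0 < 1 + |lam|)]
    exact (norm_add_le_of_le b1 b2).trans (by norm_num)
  · have hl0 : 0 < |lam| := by linarith
    set a := 1 / |lam| with ha
    have ha0 : 0 < a := by positivity
    have ha1 : a ≤ 1 := (div_le_one hl0).mpr h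
    have b1 : ‖∫ v in (0 : ℝ)..a, (Complex.exp (Complex.I * lam * v) - 1) / (v : ℂ)‖ ≤ 1 := by
      refine (intervalIntegral.norm_integral_le_of_norm_le_const
        fun v _ => norm_dickman_integrand_le lam v).trans ?_
      rw [sub_zero, abs_of_pos ha0, ha]
      exact (mul_one_div_cancel hl0.ne').le
    have hne : ∀ v ∈ Set.Icc a 1, v ≠ 0 := fun v hv => by linarith [hv.1]
    have i1 : IntervalIntegrable (fun v : ℝ => Complex.exp (Complex.I * lam * v) / (v : ℂ))
        volume a 1 := by
      rw [intervalIntegrable_iff_integrableOn_Icc_of_le ha1]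
      refine ContinuousOn.integrableOn_Icc fun v hv => ContinuousAt.continuousWithinAt ?_
      have : (v : ℂ) ≠ 0 := by exact_mod_cast hne v hv
      fun_prop (disch := assumption)
    have i2 : IntervalIntegrable (fun v : ℝ => ((v⁻¹ : ℝ) : ℂ)) volume a 1 := by
      rw [intervalIntegrable_iff_integrableOn_Icc_of_le ha1]
      refine ContinuousOn.integrableOn_Icc fun v hv => ContinuousAt.continuousWithinAt ?_
      have := hne v hv
      fun_prop (disch := assumption)
    have e1 : ∫ v in a..1, (Complex.exp (Complex.I * lam * v) - 1) / (v : ℂ) =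
        (∫ v in a..1, Complex.exp (Complex.I * lam * v) / (v : ℂ)) - Real.log |lam| := by
      have h3 : ∫ v in a..1, ((v⁻¹ : ℝ) : ℂ) = (Real.log |lam| : ℂ) := by
        rw [intervalIntegral.integral_ofReal, integral_inv_of_pos ha0 one_pos, ha]
        simp
      rw [← h3, ← intervalIntegral.integral_sub i1 i2]
      congr 1
      ext v
      push_cast
      ring
    have b3 : ‖((Real.log (1 + |lam|) - Real.log |lam| : ℝ) : ℂ)‖ ≤ 1 := by
      rw [Complex.norm_real, ← Real.log_div (by linarith) hl0.ne', Real.norm_eq_abs, abs_le]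
      have h1 : 1 ≤ (1 + |lam|) / |lam| := (one_le_div hl0).mpr (by linarith)
      have h2 : (1 + |lam|) / |lam| ≤ 2 := (div_le_iff₀ hl0).mpr (by linarith)
      have h3 := Real.log_nonneg h1
      have h4 := Real.log_le_sub_one_of_pos (by linarith : 0 < (1 + |lam|) / |lam|)
      constructor <;> linarith
    rw [dickmanExponent, ← intervalIntegral.integral_add_adjacent_intervals
      (intervalIntegrable_dickman_integrand lam 0 a)
      (intervalIntegrable_dickman_integrand lam a 1), e1]
    have e2 : ∀ x y z w : ℂ, x + (y - z) + w = x + y + (w - z) := fun x y z w => by ring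
    rw [e2, ← Complex.ofReal_sub]
    exact (norm_add_le_of_le (norm_add_le_of_le b1 (norm_integral_exp_div_le h)) b3).trans
      (by norm_num)

theorem norm_dickmanChar_le (α : ℂ) (lam : ℝ) :
    ‖dickmanChar α lam‖ ≤ Real.exp (‖α‖ * 5) * (1 + |lam|) ^ (-α.re) := by
  have hpos : 0 < 1 + |lam| := by positivity
  rw [dickmanChar, Complex.norm_exp, Real.rpow_def_of_pos hpos, ← Real.exp_add, Real.exp_le_exp]
  change (α * dickmanExponent lam).re ≤ _
  have e : α * dickmanExponent lam =
      α * (dickmanExponent lam + Real.log (1 + |lam|)) - α * Real.log (1 + |lam|) := by ring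
  rw [e, Complex.sub_re, Complex.re_mul_ofReal]
  have h1 : (α * (dickmanExponent lam + Real.log (1 + |lam|))).re ≤ ‖α‖ * 5 := by
    refine (Complex.re_le_norm _).trans ?_
    rw [norm_mul]
    exact mul_le_mul_of_nonneg_left (norm_dickmanExponent_add_log_le lam) (norm_nonneg _)
  linarith


/-! ### Comparison with the main term at a general truncation -/

theorem exists_norm_le_one_add_abs_rpow {η A : ℝ} (hη : 0 ≤ η) (hA : 0 < A) {g : ℝ → ℂ}
    (hg : ∀ lam : ℝ, ‖g lam‖ ≤ A / (1 + |lam| ^ η)) :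
    ∃ B : ℝ, 0 < B ∧ ∀ lam : ℝ, ‖g lam‖ ≤ B * (1 + |lam|) ^ (-η) := by
  refine ⟨A * 2 ^ η, by positivity, fun lam => (hg lam).trans ?_⟩
  have hl := abs_nonneg lam
  have hp : 0 < 1 + |lam| := by linarith
  have h1 : (1 + |lam|) ^ η ≤ 2 ^ η * (1 + |lam| ^ η) := by
    rcases le_total |lam| 1 with h | h
    · calc (1 + |lam|) ^ η ≤ 2 ^ η := Real.rpow_le_rpow hp.le (by linarith) hη
        _ ≤ _ := le_mul_of_one_le_right (by positivity) (by
          linarith [Real.rpow_nonneg hl η])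
    · calc (1 + |lam|) ^ η ≤ (2 * |lam|) ^ η := Real.rpow_le_rpow hp.le (by linarith) hη
        _ = 2 ^ η * |lam| ^ η := Real.mul_rpow (by norm_num) hl
        _ ≤ _ := by gcongr; linarith
  have h2 : 0 < (1 + |lam|) ^ η := by positivity
  rw [Real.rpow_neg hp.le, ← div_eq_mul_inv, div_le_div_iff₀ (by positivity) h2]
  nlinarith

theorem integrable_one_add_abs_rpow {η : ℝ} (hη : 1 < η) :
    Integrable fun lam : ℝ => (1 + |lam|) ^ (-η) := by
  simpa using integrable_one_add_norm (E := ℝ) (μ := volume) (r := η) (by simpa using hη)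

theorem setIntegral_one_add_abs_rpow_le {η R : ℝ} (hη : 1 < η) (hR : 0 < R) :
    ∫ lam in {lam : ℝ | |lam| ≤ R}ᶜ, (1 + |lam|) ^ (-η) ≤ 2 / (η - 1) * R ^ (1 - η) := by
  have hm : MeasurableSet {lam : ℝ | |lam| ≤ R} :=
    measurableSet_le measurable_norm measurable_const
  have e : ∫ lam in {lam : ℝ | |lam| ≤ R}ᶜ, (1 + |lam|) ^ (-η) =
      2 * ∫ x in Set.Ioi R, (1 + x) ^ (-η) := by
    rw [← integral_indicator hm.compl]
    have h1 := integral_comp_abs (f := (Set.Ioi R).indicator fun x : ℝ => (1 + x) ^ (-η))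
    rw [setIntegral_indicator measurableSet_Ioi,
      Set.inter_eq_right.mpr (Set.Ioi_subset_Ioi hR.le)] at h1
    rw [← h1]
    congr 1
    ext lam
    by_cases h : |lam| ≤ R
    · rw [Set.indicator_of_notMem (by simpa using h), Set.indicator_of_notMem (by simpa using h)]
    · rw [Set.indicator_of_mem (by simpa using h), Set.indicator_of_mem (by simpa using h)]
  have h2 : ∫ x in Set.Ioi R, (1 + x) ^ (-η) ≤ ∫ x in Set.Ioi R, x ^ (-η) := by
    refine setIntegral_mono_on ?_ (integrableOn_Ioi_rpow_of_lt (by linarith) hR)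
      measurableSet_Ioi fun x hx => ?_
    · refine ((integrable_one_add_abs_rpow hη).integrableOn (s := Set.Ioi R)).congr_fun
        (fun x hx => ?_) measurableSet_Ioi
      simp only
      rw [abs_of_pos (hR.trans hx)]
    · exact Real.rpow_le_rpow_of_nonpos (hR.trans hx) (by linarith) (by linarith)
  rw [integral_Ioi_rpow_of_lt (by linarith) hR] at h2
  rw [e]
  have h3 : -R ^ (-η + 1) / (-η + 1) = R ^ (1 - η) / (η - 1) := by
    rw [show -η + 1 = 1 - η by ring, show η - 1 = -(1 - η) by ring, neg_div, div_neg]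
  rw [h3] at h2
  calc _ ≤ 2 * (R ^ (1 - η) / (η - 1)) := by gcongr
    _ = _ := by ring

theorem continuous_eulerProd (k : ℕ) (α : ℂ) (N : ℝ) : Continuous (eulerProd k α N) := by
  unfold eulerProd primeWeight
  fun_prop

theorem smoothSum_eq_integral {k : ℕ} (hk : k ≠ 0) (α : ℂ) {f g : ℝ → ℂ} (hf : Continuous f)
    (hg : Integrable g) (h : IsFourierTransform f g) {N : ℝ} :
    smoothSum f k α N = ∫ lam : ℝ, g lam * eulerProd k α N (lam / Real.log N) := by
  have hint : ∀ n : ℕ, Integrable fun lam : ℝ => g lam * omegaTerm α (lam / Real.log N) n := by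
    intro n
    refine hg.mul_bdd (c := ‖α ^ ArithmeticFunction.cardFactors n / (n : ℂ)‖) ?_ ?_
    · unfold omegaTerm
      exact (by fun_prop : Continuous _).aestronglyMeasurable
    · filter_upwards with lam
      rw [omegaTerm, norm_mul, mul_comm Complex.I, Complex.norm_exp_ofReal_mul_I, one_mul]
  simp_rw [← sum_smoothKFree_eq_eulerProd hk, Finset.mul_sum]
  rw [integral_finsetSum _ fun n _ => hint n, smoothSum]
  refine Finset.sum_congr rfl fun n _ => ?_
  rw [eq_integral_of_isFourierTransform hf hg h, ← integral_mul_const]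
  congr 1
  ext lam
  rw [omegaTerm, ← mul_assoc]
  congr 3
  push_cast
  ring

/-- Quantitative comparison of `smoothSum` with its main term, for a general truncation `R`. -/
theorem exists_smoothSum_bound {k : ℕ} (hk : 2 ≤ k) {α : ℂ} (hα : ‖α‖ < 2) :
    ∃ C : ℂ, C ≠ 0 ∧ ∃ K₀ : ℝ, 0 < K₀ ∧ ∀ (η : ℝ) (f g : ℝ → ℂ), 1 < η → Continuous f →
      MemS η f g → ∀ q δ : ℝ, 0 ≤ q → 0 < δ → 2 + δ - α.re - η ≤ q →
      ∃ K : ℝ, 0 < K ∧ ∀ N R : ℝ, 2 ≤ N → 0 < R →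
        K₀ * ((1 + R) * (1 + |Real.log (Real.log N)|) / Real.log N) ≤ 1 →
        ‖smoothSum f k α N / (C * (Real.log N : ℂ) ^ α) - mainIntegral α g R‖ ≤
          K * ((1 + |Real.log (Real.log N)|) / Real.log N * (1 + R) ^ q +
            Real.log N ^ (‖α‖ - α.re) * R ^ (1 - η)) := by
  obtain ⟨C, hC, K₀, hK₀, hE⟩ := exists_eulerProd_eq hk hα
  obtain ⟨K₁, hK₁, hP⟩ := exists_norm_eulerProd_le hk hα
  refine ⟨C, hC, K₀, hK₀, fun η f g hη hf hS q δ hq hδ hqδ => ?_⟩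
  obtain ⟨hft, A, hA, hgA⟩ := hS
  obtain ⟨B, hB, hgB⟩ := exists_norm_le_one_add_abs_rpow (by linarith) hA hgA
  have hgm := aestronglyMeasurable_of_isFourierTransform hft
  have hgi : Integrable g := ((integrable_one_add_abs_rpow hη).const_mul B).mono' hgm
    (Filter.Eventually.of_forall hgB)
  set I := ∫ lam : ℝ, (1 + |lam|) ^ (-(1 + δ)) with hI
  have hI0 : 0 ≤ I := integral_nonneg fun lam => by positivity
  have hIi := integrable_one_add_abs_rpow (by linarith : 1 < 1 + δ)
  have hCn : 0 < ‖C‖ := norm_pos_iff.mpr hC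
  have hη1 : 0 < η - 1 := by linarith
  set K₂ := B * Real.exp (‖α‖ * 5) * (2 * K₀) with hK₂
  set K₃ := B * K₁ / ‖C‖ * (2 / (η - 1)) with hK₃
  have hK₂0 : 0 < K₂ := by positivity
  have hK₃0 : 0 < K₃ := by positivity
  refine ⟨K₂ * I + K₃, by positivity, fun N R hN hR hsmall => ?_⟩
  have hlN : 0 < Real.log N := Real.log_pos (by linarith)
  have hlNc : (Real.log N : ℂ) ≠ 0 := by exact_mod_cast hlN.ne'
  set Λ := 1 + |Real.log (Real.log N)| with hΛ
  have hΛ0 : 0 < Λ := by positivity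
  set D := C * (Real.log N : ℂ) ^ α with hD
  have hD0 : D ≠ 0 := mul_ne_zero hC (by rw [Complex.cpow_def_of_ne_zero hlNc]; exact Complex.exp_ne_zero _)
  have hDn : ‖D‖ = ‖C‖ * Real.log N ^ α.re := by
    rw [hD, norm_mul, Complex.norm_cpow_eq_rpow_re_of_pos hlN]
  set P : ℝ → ℂ := fun lam => eulerProd k α N (lam / Real.log N) with hPdef
  have hPc : Continuous P := (continuous_eulerProd k α N).comp (continuous_id.div_const _)
  have hgP : Integrable fun lam => g lam * P lam :=
    hgi.mul_bdd (c := K₁ * Real.log N ^ ‖α‖) hPc.aestronglyMeasurable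
      (Filter.Eventually.of_forall fun lam => hP N hN _)
  set S : Set ℝ := {lam : ℝ | |lam| ≤ R} with hSdef
  have hSm : MeasurableSet S := measurableSet_le measurable_norm measurable_const
  have hSc : S = Set.Icc (-R) R := by ext x; simp [hSdef, abs_le]
  have hφg : IntegrableOn (fun lam => dickmanChar α lam * g lam) S := by
    rw [hSc]
    exact hgi.integrableOn.continuousOn_mul (continuous_dickmanChar α).continuousOn isCompact_Icc
  have hsplit : smoothSum f k α N / D - mainIntegral α g R =
      (∫ lam in S, (g lam * P lam / D - dickmanChar α lam * g lam)) +
        ∫ lam in Sᶜ, g lam * P lam / D := by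
    rw [smoothSum_eq_integral (by omega) α hf hgi hft, mainIntegral,
      integral_sub (hgP.div_const D).integrableOn hφg, integral_div, integral_div,
      ← integral_add_compl hSm hgP]
    ring
  have hin : ‖∫ lam in S, (g lam * P lam / D - dickmanChar α lam * g lam)‖ ≤
      K₂ * I * (Λ / Real.log N * (1 + R) ^ q) := by
    calc _ ≤ ∫ lam in S, K₂ * (Λ / Real.log N * (1 + R) ^ q) * (1 + |lam|) ^ (-(1 + δ)) := by
          refine norm_integral_le_of_norm_le (hIi.const_mul _).integrableOn ?_
          filter_upwards [ae_restrict_mem hSm] with lam hlam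
          have hlR : |lam| ≤ R := hlam
          have hw : 0 < 1 + |lam| := by positivity
          obtain ⟨E, hEb, hEP⟩ := hE N hN lam
          -- The smallness condition on `R` makes `|e^E - 1| ≤ 2|E|` available on the whole
          -- truncated range.
          have hE1 : ‖E‖ ≤ 1 := hEb.trans (le_trans (by gcongr) hsmall)
          have hexp := (Complex.norm_exp_sub_one_le hE1).trans
            (mul_le_mul_of_nonneg_left hEb zero_le_two)
          have e : g lam * P lam / D - dickmanChar α lam * g lam =
              g lam * dickmanChar α lam * (Complex.exp E - 1) := by
            simp only [hPdef]
            rw [hEP, ← hD]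
            field_simp
          rw [e, norm_mul, norm_mul]
          -- The three factors bound `f̂`, `φ` and the growth of `E`. The power `q` is bounded at
          -- `|λ| = R`, while `-(1 + δ)` leaves an integrable weight of mass `I` independent of `R`.
          have hpow : (1 + |lam|) ^ (-η) * (1 + |lam|) ^ (-α.re) * (1 + |lam|) ≤
              (1 + R) ^ q * (1 + |lam|) ^ (-(1 + δ)) := by
            rw [← Real.rpow_add hw, ← Real.rpow_add_one hw.ne']
            calc (1 + |lam|) ^ (-η + -α.re + 1) ≤ (1 + |lam|) ^ (q + -(1 + δ)) :=
                  Real.rpow_le_rpow_of_exponent_le (by linarith [abs_nonneg lam]) (by linarith)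
              _ = (1 + |lam|) ^ q * (1 + |lam|) ^ (-(1 + δ)) := Real.rpow_add hw _ _
              _ ≤ _ := by gcongr
          calc _ ≤ B * (1 + |lam|) ^ (-η) * (Real.exp (‖α‖ * 5) * (1 + |lam|) ^ (-α.re)) *
                (2 * (K₀ * ((1 + |lam|) * Λ / Real.log N))) := by
                gcongr
                · exact hgB lam
                · exact norm_dickmanChar_le α lam
            _ = K₂ * (Λ / Real.log N) *
                ((1 + |lam|) ^ (-η) * (1 + |lam|) ^ (-α.re) * (1 + |lam|)) := by
                rw [hK₂]; ring
            _ ≤ K₂ * (Λ / Real.log N) * ((1 + R) ^ q * (1 + |lam|) ^ (-(1 + δ))) := by gcongr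
            _ = _ := by ring
      _ ≤ ∫ lam, K₂ * (Λ / Real.log N * (1 + R) ^ q) * (1 + |lam|) ^ (-(1 + δ)) :=
          setIntegral_le_integral (hIi.const_mul _)
            (Filter.Eventually.of_forall fun lam => by positivity)
      _ = _ := by rw [integral_const_mul, ← hI]; ring
  have hout : ‖∫ lam in Sᶜ, g lam * P lam / D‖ ≤
      K₃ * (Real.log N ^ (‖α‖ - α.re) * R ^ (1 - η)) := by
    calc _ ≤ ∫ lam in Sᶜ, B * K₁ / ‖C‖ * Real.log N ^ (‖α‖ - α.re) * (1 + |lam|) ^ (-η) := by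
          refine norm_integral_le_of_norm_le
            ((integrable_one_add_abs_rpow hη).const_mul _).integrableOn ?_
          filter_upwards with lam
          rw [norm_div, norm_mul, hDn]
          calc _ ≤ B * (1 + |lam|) ^ (-η) * (K₁ * Real.log N ^ ‖α‖) /
                (‖C‖ * Real.log N ^ α.re) := by
                gcongr
                · exact hgB lam
                · exact hP N hN _
            _ = _ := by rw [Real.rpow_sub hlN]; field_simp
      _ ≤ B * K₁ / ‖C‖ * Real.log N ^ (‖α‖ - α.re) * (2 / (η - 1) * R ^ (1 - η)) := by
          rw [integral_const_mul]
          gcongr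
          exact setIntegral_one_add_abs_rpow_le hη hR
      _ = _ := by rw [hK₃]; ring
  rw [hsplit]
  refine (norm_add_le_of_le hin hout).trans ?_
  have x1 : 0 ≤ Λ / Real.log N * (1 + R) ^ q := by positivity
  have x2 : 0 ≤ Real.log N ^ (‖α‖ - α.re) * R ^ (1 - η) := by positivity
  nlinarith [mul_nonneg (mul_nonneg hK₂0.le hI0) x2, mul_nonneg hK₃0.le x1]

/-! ### Truncation at a power of log N -/

theorem eventually_one_add_abs_log_le {c s : ℝ} (hc : 0 < c) (hs : 0 < s) :
    ∀ᶠ L : ℝ in Filter.atTop, 1 + |Real.log L| ≤ c * L ^ s := by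
  have h1 := (isLittleO_log_rpow_atTop hs).bound (half_pos hc)
  have h2 := (tendsto_rpow_atTop hs).eventually_ge_atTop (2 / c)
  filter_upwards [h1, h2, Filter.eventually_gt_atTop 0] with L h1 h2 h3
  rw [Real.norm_eq_abs, Real.norm_of_nonneg (by positivity)] at h1
  have h4 : 1 ≤ c / 2 * L ^ s := by
    calc (1 : ℝ) = c / 2 * (2 / c) := by field_simp
      _ ≤ _ := by gcongr
  linarith

/-- With `R = L^{1-τ}` the quantity is of order `L^{-τ} log L`, which tends to 0 because `τ > 0`. -/
theorem eventually_truncation_small {c τ : ℝ} (hc : 0 < c) (hτ : 0 < τ) (hτ1 : τ < 1) :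
    ∀ᶠ L : ℝ in Filter.atTop, c * ((1 + L ^ (1 - τ)) * (1 + |Real.log L|) / L) ≤ 1 := by
  filter_upwards [eventually_one_add_abs_log_le (by positivity : 0 < 1 / (2 * c)) hτ,
    Filter.eventually_ge_atTop 1] with L hL hL1
  have hL0 : 0 < L := by linarith
  have h1 : 1 ≤ L ^ (1 - τ) := Real.one_le_rpow hL1 (by linarith)
  have h2 : L ^ (1 - τ) * L ^ τ = L := by rw [← Real.rpow_add hL0]; simp
  calc c * ((1 + L ^ (1 - τ)) * (1 + |Real.log L|) / L)
      ≤ c * ((L ^ (1 - τ) + L ^ (1 - τ)) * (1 / (2 * c) * L ^ τ) / L) := by gcongr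
    _ = L ^ (1 - τ) * L ^ τ / L := by field_simp; ring
    _ = 1 := by rw [h2, div_self hL0.ne']

/-- The bound of `exists_smoothSum_bound` for the truncation `R = (log N) ^ (1 - τ)`. -/
theorem exists_smoothSum_bound_rpow {k : ℕ} (hk : 2 ≤ k) {α : ℂ} (hα : ‖α‖ < 2) :
    ∃ C : ℂ, C ≠ 0 ∧ ∀ (η τ : ℝ) (f g : ℝ → ℂ), 1 < η → 0 < τ → τ < 1 → Continuous f →
      MemS η f g → ∀ q δ : ℝ, 0 ≤ q → 0 < δ → 2 + δ - α.re - η ≤ q →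
      ∃ K : ℝ, 0 < K ∧ ∀ᶠ N : ℝ in Filter.atTop,
        ‖smoothSum f k α N / (C * (Real.log N : ℂ) ^ α) -
            mainIntegral α g (Real.log N ^ (1 - τ))‖ ≤
          K * ((1 + |Real.log (Real.log N)|) * Real.log N ^ ((1 - τ) * q - 1) +
            Real.log N ^ (‖α‖ - α.re + (1 - τ) * (1 - η))) := by
  obtain ⟨C, hC, K₀, hK₀, hmain⟩ := exists_smoothSum_bound hk hα
  refine ⟨C, hC, fun η τ f g hη hτ hτ1 hf hS q δ hq hδ hqδ => ?_⟩
  obtain ⟨K, hK, hbd⟩ := hmain η f g hη hf hS q δ hq hδ hqδ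
  refine ⟨K * 2 ^ q, by positivity, ?_⟩
  filter_upwards [Real.tendsto_log_atTop.eventually (eventually_truncation_small hK₀ hτ hτ1),
    Real.tendsto_log_atTop.eventually (Filter.eventually_ge_atTop 1),
    Filter.eventually_ge_atTop 2] with N h1 h2 h3
  set L := Real.log N
  have hL0 : 0 < L := by linarith
  have hR1 : 1 ≤ L ^ (1 - τ) := Real.one_le_rpow h2 (by linarith)
  refine (hbd N (L ^ (1 - τ)) h3 (by positivity) h1).trans ?_
  have e1 : L ^ (‖α‖ - α.re) * (L ^ (1 - τ)) ^ (1 - η) =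
      L ^ (‖α‖ - α.re + (1 - τ) * (1 - η)) := by
    rw [← Real.rpow_mul hL0.le, ← Real.rpow_add hL0]
  have h4 : (1 + L ^ (1 - τ)) ^ q ≤ 2 ^ q * L ^ ((1 - τ) * q) := by
    calc (1 + L ^ (1 - τ)) ^ q ≤ (2 * L ^ (1 - τ)) ^ q :=
          Real.rpow_le_rpow (by positivity) (by linarith) hq
      _ = _ := by rw [Real.mul_rpow (by norm_num) (by positivity), ← Real.rpow_mul hL0.le]
  have h5 : (1 : ℝ) ≤ 2 ^ q := Real.one_le_rpow (by norm_num) hq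
  rw [e1]
  calc _ ≤ K * ((1 + |Real.log L|) / L * (2 ^ q * L ^ ((1 - τ) * q)) +
        2 ^ q * L ^ (‖α‖ - α.re + (1 - τ) * (1 - η))) := by
        gcongr
        exact le_mul_of_one_le_left (by positivity) h5
    _ = _ := by
        rw [Real.rpow_sub_one hL0.ne']
        ring

end SmoothSums

/-! ### Choice of exponents in the two ranges of τ -/

theorem corollary2 (k : ℕ) (hk : 2 ≤ k) (α : ℂ) (hα0 : α ≠ 0) (hα : ‖α‖ < 2) :
    ∃ C : ℂ, C ≠ 0 ∧
      ∀ (η : ℝ) (f fhat : ℝ → ℂ) (τ : ℝ),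
        ‖α‖ - α.re + 1 < η →
        Continuous f →
        (∃ M : ℝ, ∀ x : ℝ, ‖f x‖ ≤ M) →
        SmoothSums.MemS η f fhat →
        ∃ ε : ℝ → ℂ,
          (∀ N : ℝ, 2 ≤ N →
            SmoothSums.smoothSum f k α N =
              C * (Real.log N : ℂ) ^ α *
                (SmoothSums.mainIntegral α fhat (Real.log N ^ (1 - τ)) + ε N)) ∧
          (0 < τ → τ ≤ (η - (‖α‖ - α.re + 2)) / (η - 1) →
            ε =O[Filter.atTop] fun N : ℝ => Real.log (Real.log N) / Real.log N) ∧
          (max 0 ((η - (‖α‖ - α.re + 2)) / (η - 1)) < τ →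
            τ < (η - (‖α‖ - α.re + 1)) / (η - 1) →
            ε =O[Filter.atTop] fun N : ℝ =>
              Real.log N ^ (-η * (1 - τ) - τ + (‖α‖ - α.re + 1))) := by
  obtain ⟨C, hC, hmain⟩ := SmoothSums.exists_smoothSum_bound_rpow hk hα
  have hαpos : 0 < ‖α‖ := norm_pos_iff.mpr hα0
  have hre : α.re ≤ ‖α‖ := Complex.re_le_norm α
  refine ⟨C, hC, fun η f fhat τ hη hf _ hS => ?_⟩
  have hη1 : 0 < η - 1 := by linarith
  refine ⟨fun N => SmoothSums.smoothSum f k α N / (C * (Real.log N : ℂ) ^ α) -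
    SmoothSums.mainIntegral α fhat (Real.log N ^ (1 - τ)), fun N hN => ?_, fun hτ hτ' => ?_,
    fun hτ hτ' => ?_⟩
  · have hlNc : (Real.log N : ℂ) ≠ 0 := by
      exact_mod_cast (Real.log_pos (by linarith : (1 : ℝ) < N)).ne'
    have hD0 : C * (Real.log N : ℂ) ^ α ≠ 0 := mul_ne_zero hC (by
      rw [Complex.cpow_def_of_ne_zero hlNc]; exact Complex.exp_ne_zero _)
    rw [add_sub_cancel, mul_div_cancel₀ _ hD0]
  · have hτ1 : τ < 1 := hτ'.trans_lt ((div_lt_one hη1).mpr (by linarith))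
    have hlin : τ * (η - 1) ≤ η - (‖α‖ - α.re + 2) := (le_div_iff₀ hη1).mp hτ'
    have hpos := mul_pos hτ hη1
    -- A positive `τ` in this range forces `η > |α| - Re α + 2`. So `δ = η + Re α - 2` is positive
    -- and `q = 0` is admissible: the inner integral converges absolutely.
    obtain ⟨K, hK, hbd⟩ := hmain η τ f fhat (by linarith) hτ hτ1 hf hS 0 (η + α.re - 2) le_rfl
      (by linarith) (by linarith)
    refine Asymptotics.IsBigO.of_bound (K * 3) ?_
    filter_upwards [hbd, Real.tendsto_log_atTop.eventually (Filter.eventually_ge_atTop 1),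
      (Real.tendsto_log_atTop.comp Real.tendsto_log_atTop).eventually
        (Filter.eventually_ge_atTop 1)] with N h1 h2 h3
    simp only [Function.comp] at h3
    set L := Real.log N
    have hL0 : 0 < L := by linarith
    refine h1.trans ?_
    rw [Real.norm_of_nonneg (div_nonneg (by linarith) hL0.le), abs_of_nonneg (by linarith)]
    have e1 : L ^ ((1 - τ) * 0 - 1) = 1 / L := by
      rw [mul_zero, zero_sub, Real.rpow_neg_one, one_div]
    -- The upper bound on `τ` says exactly that this exponent is at most `-1`.
    have e2 : L ^ (‖α‖ - α.re + (1 - τ) * (1 - η)) ≤ 1 / L := by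
      rw [one_div, ← Real.rpow_neg_one]
      exact Real.rpow_le_rpow_of_exponent_le h2 (by nlinarith)
    calc _ ≤ K * ((1 + Real.log L) * (1 / L) + 1 / L) := by rw [e1]; gcongr
      _ = K * ((2 + Real.log L) / L) := by ring
      _ ≤ K * ((3 * Real.log L) / L) := by gcongr; linarith
      _ = _ := by ring
  · have hτ0 : 0 < τ := (le_max_left _ _).trans_lt hτ
    have hτ2 := (div_lt_iff₀ hη1).mp ((le_max_right _ _).trans_lt hτ)
    have hτ1 : τ < 1 := hτ'.trans_le ((div_le_one hη1).mpr (by linarith))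
    set e := ‖α‖ - α.re + (1 - τ) * (1 - η) with he
    have hee : -η * (1 - τ) - τ + (‖α‖ - α.re + 1) = e := by rw [he]; ring
    have he1 : 0 < e + 1 := by rw [he]; nlinarith
    -- This is the least admissible `q` for `δ = |α|/2`. Spending only half of `|α|` makes `(1 - τ)
    -- q - 1 < e` strict, and the resulting power of `log N` absorbs the factor `1 + |log log N|`.
    set q := max 0 (2 + ‖α‖ / 2 - α.re - η) with hq
    have hqe : (1 - τ) * q < e + 1 := by
      rcases max_cases 0 (2 + ‖α‖ / 2 - α.re - η) with ⟨h, _⟩ | ⟨h, _⟩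
      · rw [hq, h, mul_zero]; exact he1
      · rw [hq, h]
        -- If the bracket is nonnegative, dropping `1 - τ` leaves a gap `|α|/2 > 0`; otherwise the
        -- left side is at most 0 and the right side at least 1.
        have h4 : (1 - τ) * (1 + ‖α‖ / 2 - α.re) < 1 + ‖α‖ - α.re := by
          rcases le_total 0 (1 + ‖α‖ / 2 - α.re) with h5 | h5
          · nlinarith [mul_nonneg hτ0.le h5]
          · nlinarith [mul_nonneg (sub_nonneg.mpr hτ1.le) (neg_nonneg.mpr h5)]
        rw [he]
        linarith [show (1 - τ) * (2 + ‖α‖ / 2 - α.re - η) =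
          (1 - τ) * (1 + ‖α‖ / 2 - α.re) + (1 - τ) * (1 - η) by ring]
    obtain ⟨K, hK, hbd⟩ := hmain η τ f fhat (by linarith) hτ0 hτ1 hf hS q (‖α‖ / 2)
      (le_max_left _ _) (by linarith) (le_max_right _ _)
    rw [hee]
    refine Asymptotics.IsBigO.of_bound (K * 2) ?_
    filter_upwards [hbd, Real.tendsto_log_atTop.eventually (Filter.eventually_ge_atTop 1),
      Real.tendsto_log_atTop.eventually (SmoothSums.eventually_one_add_abs_log_le one_pos
        (by linarith : 0 < e + 1 - (1 - τ) * q))] with N h1 h2 h3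
    set L := Real.log N
    have hL0 : 0 < L := by linarith
    refine h1.trans ?_
    rw [Real.norm_of_nonneg (by positivity)]
    have e1 : L ^ (e + 1 - (1 - τ) * q) * L ^ ((1 - τ) * q - 1) = L ^ e := by
      rw [← Real.rpow_add hL0]; congr 1; ring
    rw [one_mul] at h3
    calc _ ≤ K * (L ^ (e + 1 - (1 - τ) * q) * L ^ ((1 - τ) * q - 1) + L ^ e) := by gcongr
      _ = _ := by rw [e1]; ring
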